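/- Let $z=(q_1,q_2,p_1,p_2)$ be the coordinates of $\mathbb R^4$ with canonical Poisson tensor $P=\begin{pmatrix}0&I\\-I&0\end{pmatrix}$, and let $M\subset\mathbb R^4$ be a nonempty open set. For a second bivector field $P'$ put $N=P'P^{-1}$ and write $\det(x-N)=(x^2-\sigma_1x-\sigma_2)^2$. Consider smooth $V(q_1,q_2)$ on the projection of $M$, smooth $H_2$ on $M$, and $H_1=p_1^2+p_2^2+V(q_1,q_2)$. We say that $(P',V,H_2)$ is a *nontrivial solution* on $M$ if * $P'$ is a smooth Poisson tensor on $M$ (skew-symmetric, satisfying the Jacobi identity), and so is $P+tP'$ for every $t\in\mathbb R$; * $(M,P,P')$ is semisimple and regular: at every point of $M$ the operator $N$ has two distinct (real or complex) eigenvalues, and these eigenvalues, as local functions, are functionally independent; * the Lenard–Magri relations $N^*dH_1=dH_2$, $N^*dH_2=\sigma_2\,dH_1+\sigma_1\,dH_2$ hold on $M$; * $H_1,H_2$ are functionally independent and in involution with respect to the brackets of $P$ and $P'$, $dH_1\not\equiv0$, $dH_2\not\equiv 0$, and $V$ is not constant. (Two functions are functionally independent if their differentials are linearly independent on a dense subset.)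 For $a,b\in\mathbb R\setminus\{0\}$ let $$P'_{a,b}=\begin{pmatrix}0&a&p_1&0\\-a&0&0&p_2\\-p_1&0&0&b\,e^{(q_2-q_1)/a}\\0&-p_2&-b\,e^{(q_2-q_1)/a}&0\end{pmatrix},\qquad V_{a,b}=2ab\,e^{(q_2-q_1)/a},$$ $$H_1^{a,b}=p_1^2+p_2^2+V_{a,b},\qquad H_2^{a,b}=(p_1+p_2)H_1^{a,b}-\tfrac13(p_1+p_2)^3$$ be the data of the open Toda lattice. Consider the ansatz $$P'=\begin{pmatrix}0&h(q)&c_1p_1+c_2p_2&c_3p_1+c_4p_2\\ *&0&c_5p_1+c_6p_2&c_7p_1+c_8p_2\\ *&*&0&f(q)\\ *&*&*&0\end{pmatrix}\quad\text{(skew-symmetric)},\qquad c_k\in\mathbb R,\qquad(\ast)$$ with functions $h,f$ of $q=(q_1,q_2)$. Then, up to canonical transformations, rescaling of $P'$ and additive constants in the integrals, the open Toda lattice is the only nontrivial solution of the form $(\ast)$: 1. For all $a,b\ne0$, $P'_{a,b}$ is of the form $(\ast)$; the set where its $N$ has two distinct eigenvalues is open and dense in $\mathbb R^4$, and is all of $\mathbb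 R^4$ if $ab>0$; and $(P'_{a,b},V_{a,b},H_2^{a,b})$ is a nontrivial solution on every nonempty open subset of this set. 2. If $M$ is open and connected and $(P',V,H_2)$ is a nontrivial solution on $M$ with $P'$ of the form $(\ast)$, then there are constants $a,b,k\neq0$ and $C_1,C_2\in\mathbb R$ such that every point of $M$ has an open neighbourhood $W\subset M$ and a canonical transformation $\varphi$ (a smooth injective map $W\to\mathbb R^4$ whose Jacobi matrix $J$ satisfies $JPJ^{T}=P$) with $$JP'J^{T}=k\,P'_{a,b}\circ\varphi,\qquad H_1=H_1^{a,b}\circ\varphi+C_1,\qquad H_2=k\,H_2^{a,b}\circ\varphi+C_2\qquad\text{on }W.$$ -/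

import Mathlib

open scoped ContDiff

/-- The phase space `ℝ⁴`, with coordinates `z = (q₁, q₂, p₁, p₂)`. -/
abbrev Phase : Type := Fin 4 → ℝ

/-- The configuration part `(q₁, q₂)` of a point of phase space. -/
def qpart (z : Phase) : ℝ × ℝ := (z 0, z 1)

/-- The partial derivative `∂F/∂z_m`. -/
noncomputable def pd (m : Fin 4) (F : Phase → ℝ) (z : Phase) : ℝ :=
  fderiv ℝ F z (Pi.single m 1)

/-- The components of the differential `dF`. -/
noncomputable def grad (F : Phase → ℝ) (z : Phase) : Fin 4 → ℝ :=
  fun m => pd m F z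

/-- The canonical Poisson tensor `P` (constant on `ℝ⁴`). -/
def canP : Matrix (Fin 4) (Fin 4) ℝ :=
  !![0, 0, 1, 0;
     0, 0, 0, 1;
    -1, 0, 0, 0;
     0, -1, 0, 0]

/-- The bracket `{F, G} = ∑ Q_ij ∂F/∂z_i ∂G/∂z_j` of a bivector field `Q`. -/
noncomputable def bracket (Q : Phase → Matrix (Fin 4) (Fin 4) ℝ) (F G : Phase → ℝ)
    (z : Phase) : ℝ :=
  ∑ i, ∑ j, Q z i j * pd i F z * pd j G z

/-- `Q` is a smooth Poisson tensor on the open set `M`: skew-symmetry and the Jacobi identity. -/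
structure IsPoissonOn (M : Set Phase) (Q : Phase → Matrix (Fin 4) (Fin 4) ℝ) : Prop where
  smooth : ∀ i j, ContDiffOn ℝ ∞ (fun z => Q z i j) M
  skew : ∀ z ∈ M, ∀ i j, Q z i j = - Q z j i
  jacobi : ∀ z ∈ M, ∀ i j k,
    ∑ m, (Q z i m * pd m (fun w => Q w j k) z
        + Q z j m * pd m (fun w => Q w k i) z
        + Q z k m * pd m (fun w => Q w i j) z) = 0

/-- The recursion operator `N = P' P⁻¹`; its adjoint `N*`, acting on differentials, is the
transposed matrix. -/
noncomputable def recOp (P' : Phase → Matrix (Fin 4) (Fin 4) ℝ) (z : Phase) :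
    Matrix (Fin 4) (Fin 4) ℝ :=
  P' z * canP⁻¹

/-- The control matrix `F` of the Lenard-Magri chain for `n = 2`. -/
def controlMatrix (s₁ s₂ : ℝ) : Matrix (Fin 2) (Fin 2) ℝ :=
  !![0, 1;
     s₂, s₁]

/-- The relations `N* dH_j = ∑ₖ F_jk dH_k` with the Lenard-Magri control matrix; its entries
are read off from `Δ(x) = det (x - N)^{1/2} = x² - σ₁ x - σ₂`. -/
def LenardMagriOn (M : Set Phase) (P' : Phase → Matrix (Fin 4) (Fin 4) ℝ)
    (H₁ H₂ : Phase → ℝ) : Prop :=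
  ∀ z ∈ M, ∃ s₁ s₂ : ℝ,
    (recOp P' z).charpoly
        = (Polynomial.X ^ 2 - Polynomial.C s₁ * Polynomial.X - Polynomial.C s₂) ^ 2 ∧
    ∀ j : Fin 2, (recOp P' z).transpose.mulVec (grad (![H₁, H₂] j) z)
      = ∑ k : Fin 2, controlMatrix s₁ s₂ j k • grad (![H₁, H₂] k) z

/-- Functional independence on `M`: the differentials are linearly independent at the points of
a dense subset of `M`. (`𝕜` is `ℝ`, or `ℂ` for complex-valued functions on phase space.) -/
def FunctionallyIndependentOn (𝕜 : Type) [RCLike 𝕜] (M : Set Phase) (F G : Phase → 𝕜) : Prop :=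
  M ⊆ closure {z ∈ M | LinearIndependent 𝕜 ![fderiv ℝ F z, fderiv ℝ G z]}

/-- The set of eigenvalues of the recursion operator at `z`. -/
noncomputable def eigenvalues (P' : Phase → Matrix (Fin 4) (Fin 4) ℝ) (z : Phase) : Set ℂ :=
  spectrum ℂ ((recOp P' z).map (algebraMap ℝ ℂ))

/-- The points at which the recursion operator has `n = 2` distinct eigenvalues. -/
def semisimpleLocus (P' : Phase → Matrix (Fin 4) (Fin 4) ℝ) : Set Phase :=
  {z | (eigenvalues P' z).ncard = 2}

/-- The eigenvalues of the recursion operator are functionally independent on `M`. -/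
def RegularOn (M : Set Phase) (P' : Phase → Matrix (Fin 4) (Fin 4) ℝ) : Prop :=
  ∀ z ∈ M, ∃ W : Set Phase, IsOpen W ∧ z ∈ W ∧ W ⊆ M ∧ ∃ l₁ l₂ : Phase → ℂ,
    ContDiffOn ℝ ∞ l₁ W ∧ ContDiffOn ℝ ∞ l₂ W ∧
    (∀ w ∈ W, eigenvalues P' w = {l₁ w, l₂ w}) ∧
    FunctionallyIndependentOn ℂ W l₁ l₂

/-- The ansatz for `P'`: linear in the momenta with constant coefficients
`c = (c₁, …, c₈)`, and with two functions `h`, `f` of the coordinates. -/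
def linTensor (c : Fin 8 → ℝ) (h f : ℝ × ℝ → ℝ) (z : Phase) : Matrix (Fin 4) (Fin 4) ℝ :=
  let A := c 0 * z 2 + c 1 * z 3
  let B := c 2 * z 2 + c 3 * z 3
  let C := c 4 * z 2 + c 5 * z 3
  let D := c 6 * z 2 + c 7 * z 3
  !![0, h (qpart z), A, B;
     -h (qpart z), 0, C, D;
     -A, -C, 0, f (qpart z);
     -B, -D, -f (qpart z), 0]

/-- The natural Hamiltonian `p₁² + p₂² + V(q₁, q₂)`. -/
def natHam (V : ℝ × ℝ → ℝ) (z : Phase) : ℝ := z 2 ^ 2 + z 3 ^ 2 + V (qpart z)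

/-- `(P', H₁ = p₁² + p₂² + V, H₂)` is a nontrivial solution, on the open set `M`, of the
equations of a Poisson pencil together with the Lenard-Magri chain relations, and
`(M, P, P')` is a semisimple regular bi-Hamiltonian manifold. -/
structure IsNontrivialSolution (M : Set Phase) (P' : Phase → Matrix (Fin 4) (Fin 4) ℝ)
    (V : ℝ × ℝ → ℝ) (H₂ : Phase → ℝ) : Prop where
  smooth_V : ContDiffOn ℝ ∞ V (qpart '' M)
  smooth_H₂ : ContDiffOn ℝ ∞ H₂ M
  poisson : IsPoissonOn M P'
  pencil : ∀ t : ℝ, IsPoissonOn M (fun z => canP + t • P' z)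
  chain : LenardMagriOn M P' (natHam V) H₂
  semisimple : M ⊆ semisimpleLocus P'
  regular : RegularOn M P'
  involution : ∀ z ∈ M, bracket (fun _ => canP) (natHam V) H₂ z = 0
  involution' : ∀ z ∈ M, bracket P' (natHam V) H₂ z = 0
  independent : FunctionallyIndependentOn ℝ M (natHam V) H₂
  nonzero₁ : ∃ z ∈ M, fderiv ℝ (natHam V) z ≠ 0
  nonzero₂ : ∃ z ∈ M, fderiv ℝ H₂ z ≠ 0
  nonconst : ∃ z ∈ M, ∃ z' ∈ M, V (qpart z) ≠ V (qpart z')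

/-- The Jacobi matrix of a map of the phase space. -/
noncomputable def jacobian (φ : Phase → Phase) (z : Phase) : Matrix (Fin 4) (Fin 4) ℝ :=
  Matrix.of fun i m => pd m (fun w => φ w i) z

/-- `φ` is a canonical transformation from the open set `W` onto its image:
a smooth injective map with `J P Jᵀ = P` (in particular a diffeomorphism onto an open set). -/
structure IsCanonicalOn (W : Set Phase) (φ : Phase → Phase) : Prop where
  smooth : ContDiffOn ℝ ∞ φ W
  inj : Set.InjOn φ W
  canonical : ∀ w ∈ W, jacobian φ w * canP * (jacobian φ w).transpose = canP

/-- The second Poisson tensor of the open Toda lattice. -/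
noncomputable def todaTensor (a b : ℝ) (z : Phase) : Matrix (Fin 4) (Fin 4) ℝ :=
  !![0, a, z 2, 0;
     -a, 0, 0, z 3;
     -z 2, 0, 0, b * Real.exp ((z 1 - z 0) / a);
     0, -z 3, -(b * Real.exp ((z 1 - z 0) / a)), 0]

/-- The potential of the open Toda lattice. -/
noncomputable def todaV (a b : ℝ) (q : ℝ × ℝ) : ℝ :=
  2 * a * b * Real.exp ((q.2 - q.1) / a)

/-- The second integral `(p₁ + p₂) H₁ - (p₁ + p₂)³ / 3` of the open Toda lattice. -/
noncomputable def todaH₂ (a b : ℝ) (z : Phase) : ℝ :=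
  (z 2 + z 3) * natHam (todaV a b) z - (z 2 + z 3) ^ 3 / 3

open Filter Topology

/-! ### Gradients of functions on phase space -/

/-! Write N for the recursion operator. Since xP - P' is skew-symmetric, det(x - N) is the square of
a quadratic polynomial (`det_sub_recOp`), and semisimplicity means that the discriminant of this
polynomial does not vanish. For the Toda lattice the claims are explicit computations with
gradients. The discriminant is (p₁ - p₂)² + 4ab e^((q₂-q₁)/a); its q₁-derivative never vanishes,
which gives both the density of the semisimple locus and the independence of the eigenvalues.

Conversely, the part of the Jacobi identity that is linear in P makes h affine, and the rest gives
quadratic relations between the cₖ (`linTensor_jacobi`). Closedness of N* dH₁ gives linear relations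
between the cₖ and linear equations for V (`second_integral_compat`). One consequence is that the
trace of N, a linear form in the momenta, annihilates dV. Regularity makes this form nonzero
(`not_regularOn_of_trace_or_det_eq_zero`), so after a rotation V depends on one coordinate x only,
while the trace is a multiple of the momentum p_y of the other coordinate y. The rotated
coefficients then fall into four cases (`jacobiCoeff_cases`). In two of them the determinant or the
discriminant of N vanishes. In the other two V solves an ordinary differential equation, and up to
an additive constant V is κ/x² or an exponential (`IsNontrivialSolution.classification`).

The exponential case is the Toda lattice turned by an eighth of a turn (`exists_toda_rotation`). The
inverse square case needs a nonlinear transformation (`exists_toda_map`). Let W be a quarter of the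
discriminant and t a time function with {t, W} = 1. The relative Toda motion is a Riccati equation
in t, solved by √W tanh(√W t), or by a tangent if W < 0. Its solution, together with y and p_y,
gives the new coordinates. In both cases H₂ follows up to a constant, because its differential is N*
dH₁ (`exists_local_equivalence`). -/

/-- The linear form with components `g`. -/
noncomputable def gradForm (g : Phase) : Phase →L[ℝ] ℝ :=
  ∑ i, g i • ContinuousLinearMap.proj (R := ℝ) (φ := fun _ : Fin 4 => ℝ) i

theorem gradForm_apply (g v : Phase) : gradForm g v = ∑ i, g i * v i := by
  simp [gradForm]

/-- `F` is differentiable at `z`, and its partial derivatives there are the components of `g`. -/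
def HasGrad (F : Phase → ℝ) (g : Phase) (z : Phase) : Prop := HasFDerivAt F (gradForm g) z

theorem gradForm_single (g : Phase) (m : Fin 4) : gradForm g (Pi.single m 1) = g m := by
  simp [gradForm_apply, Pi.single_apply]

theorem HasGrad.pd {F : Phase → ℝ} {g z : Phase} (hF : HasGrad F g z) (m : Fin 4) :
    pd m F z = g m := by
  rw [_root_.pd, HasFDerivAt.fderiv hF, gradForm_single]

theorem HasGrad.grad {F : Phase → ℝ} {g z : Phase} (hF : HasGrad F g z) : grad F z = g :=
  funext fun m => hF.pd m

theorem gradForm_grad (F : Phase → ℝ) (z : Phase) : gradForm (grad F z) = fderiv ℝ F z := by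
  refine ContinuousLinearMap.ext fun v => ?_
  conv_rhs => rw [← Finset.univ_sum_single v]
  rw [gradForm_apply, map_sum]
  refine Finset.sum_congr rfl fun i _ => ?_
  have : (Pi.single i (v i) : Phase) = v i • Pi.single i 1 := by
    rw [← Pi.single_smul]; simp
  rw [this, map_smul, smul_eq_mul, mul_comm]
  rfl

theorem hasGrad_of_differentiableAt {F : Phase → ℝ} {z : Phase} (hF : DifferentiableAt ℝ F z) :
    HasGrad F (grad F z) z := by
  rw [HasGrad, gradForm_grad]; exact hF.hasFDerivAt

theorem HasGrad.congr_grad {F : Phase → ℝ} {g g' z : Phase} (hF : HasGrad F g z)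
    (h : ∀ i, g i = g' i) : HasGrad F g' z := by
  rwa [← funext h]

theorem HasGrad.congr_of_eventuallyEq {F G : Phase → ℝ} {g z : Phase} (hF : HasGrad F g z)
    (h : G =ᶠ[𝓝 z] F) : HasGrad G g z :=
  HasFDerivAt.congr_of_eventuallyEq hF h

theorem HasGrad.unique {F : Phase → ℝ} {g g' z : Phase} (h : HasGrad F g z)
    (h' : HasGrad F g' z) : g = g' := by
  rw [← h.grad, h'.grad]

theorem hasGrad_const (r : ℝ) (z : Phase) : HasGrad (fun _ => r) 0 z := by
  have : gradForm 0 = 0 := by simp [gradForm]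
  rw [HasGrad, this]; exact hasFDerivAt_const r z

theorem hasGrad_coord (i : Fin 4) (z : Phase) : HasGrad (fun w => w i) (Pi.single i 1) z := by
  have : gradForm (Pi.single i 1)
      = ContinuousLinearMap.proj (R := ℝ) (φ := fun _ : Fin 4 => ℝ) i := by
    refine ContinuousLinearMap.ext fun v => ?_
    simp [gradForm_apply, Pi.single_apply]
  rw [HasGrad, this]; exact hasFDerivAt_apply i z

theorem HasGrad.add {F G : Phase → ℝ} {f g z : Phase} (hF : HasGrad F f z) (hG : HasGrad G g z) :
    HasGrad (fun w => F w + G w) (fun i => f i + g i) z := by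
  have : gradForm (fun i => f i + g i) = gradForm f + gradForm g := by
    refine ContinuousLinearMap.ext fun v => ?_
    simp [gradForm_apply, add_mul, Finset.sum_add_distrib]
  rw [HasGrad, this]; exact HasFDerivAt.add hF hG

theorem HasGrad.mul {F G : Phase → ℝ} {f g z : Phase} (hF : HasGrad F f z) (hG : HasGrad G g z) :
    HasGrad (fun w => F w * G w) (fun i => F z * g i + G z * f i) z := by
  have : gradForm (fun i => F z * g i + G z * f i) = F z • gradForm g + G z • gradForm f := by
    refine ContinuousLinearMap.ext fun v => ?_
    simp [gradForm_apply, add_mul, Finset.sum_add_distrib, Finset.mul_sum, mul_assoc]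
  rw [HasGrad, this]; exact HasFDerivAt.mul hF hG

theorem HasGrad.scomp {F : Phase → ℝ} {f z : Phase} (hF : HasGrad F f z) {u : ℝ → ℝ} {u' : ℝ}
    (hu : HasDerivAt u u' (F z)) : HasGrad (fun w => u (F w)) (fun i => u' * f i) z := by
  have : gradForm (fun i => u' * f i) = u' • gradForm f := by
    refine ContinuousLinearMap.ext fun v => ?_
    simp [gradForm_apply, Finset.mul_sum, mul_assoc]
  rw [HasGrad, this]; exact hu.comp_hasFDerivAt z hF

theorem HasGrad.const_mul {F : Phase → ℝ} {f z : Phase} (hF : HasGrad F f z) (r : ℝ) :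
    HasGrad (fun w => r * F w) (fun i => r * f i) z :=
  ((hasGrad_const r z).mul hF).congr_grad fun i => by simp

theorem HasGrad.neg {F : Phase → ℝ} {f z : Phase} (hF : HasGrad F f z) :
    HasGrad (fun w => -F w) (fun i => -f i) z := by
  simpa using hF.const_mul (-1)

theorem HasGrad.sub {F G : Phase → ℝ} {f g z : Phase} (hF : HasGrad F f z) (hG : HasGrad G g z) :
    HasGrad (fun w => F w - G w) (fun i => f i - g i) z := by
  simpa [sub_eq_add_neg] using hF.add hG.neg

theorem HasGrad.pow {F : Phase → ℝ} {f z : Phase} (hF : HasGrad F f z) (n : ℕ) :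
    HasGrad (fun w => F w ^ n) (fun i => (n * F z ^ (n - 1)) * f i) z :=
  hF.scomp (hasDerivAt_pow n (F z))

theorem HasGrad.inv {F : Phase → ℝ} {f z : Phase} (hF : HasGrad F f z) (h0 : F z ≠ 0) :
    HasGrad (fun w => (F w)⁻¹) (fun i => (-(F z ^ 2)⁻¹) * f i) z :=
  hF.scomp (hasDerivAt_inv h0)

theorem HasGrad.exp {F : Phase → ℝ} {f z : Phase} (hF : HasGrad F f z) :
    HasGrad (fun w => Real.exp (F w)) (fun i => Real.exp (F z) * f i) z :=
  hF.scomp (Real.hasDerivAt_exp (F z))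

theorem HasGrad.log {F : Phase → ℝ} {f z : Phase} (hF : HasGrad F f z) (h0 : F z ≠ 0) :
    HasGrad (fun w => Real.log (F w)) (fun i => (F z)⁻¹ * f i) z :=
  hF.scomp (Real.hasDerivAt_log h0)

theorem HasGrad.differentiableAt {F : Phase → ℝ} {f z : Phase} (hF : HasGrad F f z) :
    DifferentiableAt ℝ F z := HasFDerivAt.differentiableAt hF

theorem hasGrad_of_contDiffOn {M : Set Phase} (hM : IsOpen M) {F : Phase → ℝ}
    (hF : ContDiffOn ℝ ∞ F M) {z : Phase} (hz : z ∈ M) : HasGrad F (grad F z) z :=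
  hasGrad_of_differentiableAt
    ((hF.contDiffAt (hM.mem_nhds hz)).differentiableAt (by simp))

theorem contDiffOn_pd {M : Set Phase} (hM : IsOpen M) {F : Phase → ℝ}
    (hF : ContDiffOn ℝ ∞ F M) (m : Fin 4) : ContDiffOn ℝ ∞ (pd m F) M :=
  (hF.fderiv_of_isOpen hM (m := ∞) (by simp)).clm_apply contDiffOn_const

/-- Equality of mixed derivatives is what turns the existence of H₂ into closedness of the form N*
dH₁. -/
theorem pd_comm {M : Set Phase} (hM : IsOpen M) {F : Phase → ℝ}
    (hF : ContDiffOn ℝ ∞ F M) (i j : Fin 4) {z : Phase} (hz : z ∈ M) :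
    pd i (pd j F) z = pd j (pd i F) z := by
  have hc : ContDiffAt ℝ ∞ F z := hF.contDiffAt (hM.mem_nhds hz)
  have hs : IsSymmSndFDerivAt ℝ F z := hc.isSymmSndFDerivAt (by
    rw [minSmoothness_of_isRCLikeNormedField]; exact WithTop.coe_le_coe.2 (le_top : (2 : ℕ∞) ≤ ⊤))
  have hd : DifferentiableAt ℝ (fderiv ℝ F) z :=
    (hc.fderiv_right (m := 1) (by norm_cast)).differentiableAt (by simp)
  have key : ∀ k l : Fin 4, pd k (pd l F) z
      = fderiv ℝ (fderiv ℝ F) z (Pi.single k 1) (Pi.single l 1) := by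
    intro k l
    have h1 : HasFDerivAt (pd l F)
        ((fderiv ℝ (fderiv ℝ F) z).flip (Pi.single l 1)) z := by
      have := hd.hasFDerivAt.clm_apply (hasFDerivAt_const (Pi.single l 1 : Phase) z)
      rw [ContinuousLinearMap.comp_zero, zero_add] at this
      exact this
    rw [_root_.pd, h1.fderiv]; rfl
  rw [key, key]; exact hs _ _

/-- A function with vanishing gradient on a connected open set is constant there. -/
theorem exists_const_of_hasGrad_zero {M : Set Phase} (hM : IsOpen M) (hc : IsPreconnected M)
    {F : Phase → ℝ} (hF : ∀ z ∈ M, HasGrad F 0 z) : ∃ r, ∀ z ∈ M, F z = r := by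
  have h0 : gradForm 0 = 0 := by simp [gradForm]
  refine hM.exists_is_const_of_fderiv_eq_zero (𝕜 := ℝ) hc
    (fun z hz => (hF z hz).differentiableAt.differentiableWithinAt) fun z hz => ?_
  rw [HasFDerivAt.fderiv (hF z hz), h0]; rfl

/-- A linear form in the momenta that vanishes on a nonempty open set is zero. -/
theorem eq_zero_of_linear_momenta {M : Set Phase} (hM : IsOpen M) (hne : M.Nonempty) {r s : ℝ}
    (h : ∀ z ∈ M, r * z 2 + s * z 3 = 0) : r = 0 ∧ s = 0 := by
  obtain ⟨z, hz⟩ := hne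
  have h1 : HasGrad (fun w : Phase => r * w 2 + s * w 3) 0 z :=
    (hasGrad_const 0 z).congr_of_eventuallyEq
      (by filter_upwards [hM.mem_nhds hz] with w hw using h w hw)
  have h2 := ((hasGrad_coord 2 z).const_mul r).add ((hasGrad_coord 3 z).const_mul s)
  have h3 := h2.unique h1
  exact ⟨by simpa using congrFun h3 2, by simpa using congrFun h3 3⟩

/-- The zeros of a function with nowhere vanishing derivative have dense complement. -/
theorem subset_closure_ne_zero {M : Set Phase} (hM : IsOpen M) {F : Phase → ℝ} {m : Fin 4}
    (hF : ∀ z ∈ M, pd m F z ≠ 0) : M ⊆ closure {z ∈ M | F z ≠ 0} := by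
  intro z hz
  by_contra hcl
  rw [mem_closure_iff_frequently, not_frequently] at hcl
  have h0 : F =ᶠ[𝓝 z] fun _ => 0 := by
    filter_upwards [hcl, hM.mem_nhds hz] with w hw hwM
    by_contra h; exact hw ⟨hwM, h⟩
  refine hF z hz ?_
  rw [_root_.pd, h0.fderiv_eq]; simp

theorem jacobian_eq_of_hasGrad {φ : Phase → Phase} {J : Matrix (Fin 4) (Fin 4) ℝ} {z : Phase}
    (h : ∀ i, HasGrad (fun w => φ w i) (J i) z) : jacobian φ z = J := by
  ext i m; exact (h i).pd m

/-! ### Bivectors in block form -/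

/-- The skew-symmetric matrix with the given entries above the diagonal. -/
def blockTensor (h A B C D f : ℝ) : Matrix (Fin 4) (Fin 4) ℝ :=
  !![0, h, A, B;
     -h, 0, C, D;
     -A, -C, 0, f;
     -B, -D, -f, 0]

theorem canP_mul_neg : canP * (-canP) = 1 := by
  ext i j; fin_cases i <;> fin_cases j <;> simp [canP, Matrix.mul_apply, Fin.sum_univ_four]

theorem canP_inv : canP⁻¹ = -canP := Matrix.inv_eq_right_inv canP_mul_neg

theorem blockTensor_mul_inv (h A B C D f : ℝ) :
    blockTensor h A B C D f * canP⁻¹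
      = !![A, B, 0, -h; C, D, h, 0; 0, f, A, C; -f, 0, B, D] := by
  rw [canP_inv]
  ext i j; fin_cases i <;> fin_cases j <;>
    simp [canP, blockTensor, Matrix.mul_apply, Fin.sum_univ_four]

/-- The determinant is a square because (x - N)P = xP - P' is skew-symmetric and det P = 1: the
quadratic factor is a Pfaffian. A general commutative ring is allowed so that x can be the
polynomial variable. -/
theorem det_sub_recOp {R : Type*} [CommRing R] (x h A B C D f : R) :
    Matrix.det !![x - A, -B, 0, h; -C, x - D, -h, 0; 0, -f, x - A, -C; f, 0, -B, x - D]
      = (x ^ 2 - (A + D) * x - (B * C + h * f - A * D)) ^ 2 := by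
  simp [Matrix.det_succ_row_zero, Fin.sum_univ_succ, Fin.succAbove]
  ring

theorem charpoly_blockTensor (h A B C D f : ℝ) :
    (blockTensor h A B C D f * canP⁻¹).charpoly
      = (Polynomial.X ^ 2 - Polynomial.C (A + D) * Polynomial.X
          - Polynomial.C (B * C + h * f - A * D)) ^ 2 := by
  rw [blockTensor_mul_inv, Matrix.charpoly]
  have := det_sub_recOp (R := Polynomial ℝ) Polynomial.X (Polynomial.C h) (Polynomial.C A)
    (Polynomial.C B) (Polynomial.C C) (Polynomial.C D) (Polynomial.C f)
  simp only [← Polynomial.C_add, ← Polynomial.C_mul, ← Polynomial.C_sub] at this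
  rw [← this]
  congr 1
  ext i j : 1
  fin_cases i <;> fin_cases j <;> simp [Matrix.charmatrix]

/-! ### Eigenvalues and discriminant of the recursion operator. -/

theorem mem_spectrum_blockTensor (h A B C D f : ℝ) (l : ℂ) :
    l ∈ spectrum ℂ ((blockTensor h A B C D f * canP⁻¹).map (algebraMap ℝ ℂ))
      ↔ l ^ 2 - ((A + D : ℝ) : ℂ) * l - ((B * C + h * f - A * D : ℝ) : ℂ) = 0 := by
  rw [Matrix.mem_spectrum_iff_isRoot_charpoly, Matrix.charpoly_map, charpoly_blockTensor]
  simp [Polynomial.IsRoot]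

/-- The roots of a monic quadratic polynomial are the members of a pair of distinct numbers
exactly when the pair has the right sum and product. -/
theorem quadratic_roots_eq_pair {s d l₁ l₂ : ℂ} (hne : l₁ ≠ l₂) :
    {l : ℂ | l ^ 2 - s * l - d = 0} = {l₁, l₂} ↔ l₁ + l₂ = s ∧ l₁ * l₂ = -d := by
  constructor
  · intro h
    have h1 : l₁ ^ 2 - s * l₁ - d = 0 := by
      have : l₁ ∈ {l : ℂ | l ^ 2 - s * l - d = 0} := by rw [h]; simp
      exact this
    have h2 : l₂ ^ 2 - s * l₂ - d = 0 := by
      have : l₂ ∈ {l : ℂ | l ^ 2 - s * l - d = 0} := by rw [h]; simp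
      exact this
    have hs : l₁ + l₂ = s := by
      have : (l₁ - l₂) * (l₁ + l₂ - s) = 0 := by linear_combination h1 - h2
      rcases mul_eq_zero.1 this with h | h
      · exact absurd (sub_eq_zero.1 h) hne
      · exact sub_eq_zero.1 h
    exact ⟨hs, by linear_combination l₁ * hs - h1⟩
  · rintro ⟨hs, hp⟩
    ext l
    simp only [Set.mem_ofPred_eq, Set.mem_insert_iff, Set.mem_singleton_iff]
    have : l ^ 2 - s * l - d = (l - l₁) * (l - l₂) := by
      linear_combination l * hs - hp
    rw [this, mul_eq_zero, sub_eq_zero, sub_eq_zero]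

theorem quadratic_roots_ncard (s d : ℝ) :
    {l : ℂ | l ^ 2 - (s : ℂ) * l - (d : ℂ) = 0}.ncard = 2 ↔ s ^ 2 + 4 * d ≠ 0 := by
  constructor
  · intro h h0
    obtain ⟨x, y, hxy, he⟩ := Set.ncard_eq_two.1 h
    obtain ⟨h1, h2⟩ := (quadratic_roots_eq_pair hxy).1 he
    have h0' : (s : ℂ) ^ 2 + 4 * d = 0 := by exact_mod_cast h0
    have : (x - y) ^ 2 = 0 := by
      linear_combination (x + y + s) * h1 - 4 * h2 + h0'
    exact hxy (sub_eq_zero.1 (pow_eq_zero_iff (two_ne_zero) |>.1 this))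
  · intro h0
    obtain ⟨r, hr⟩ := IsAlgClosed.exists_pow_nat_eq ((s : ℂ) ^ 2 + 4 * d) two_pos
    have hr0 : r ≠ 0 := by
      rintro rfl
      apply h0
      have : (s : ℂ) ^ 2 + 4 * d = 0 := by rw [← hr]; simp
      exact_mod_cast this
    have hne : ((s : ℂ) + r) / 2 ≠ ((s : ℂ) - r) / 2 := by
      intro h
      apply hr0
      linear_combination h
    rw [(quadratic_roots_eq_pair hne).2 ⟨by ring, by linear_combination -hr / 4⟩]
    exact Set.ncard_pair hne

/-- Derivatives of a block tensor are again block tensors, so a Jacobi identity becomes a polynomial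
identity in the entries and their gradients. -/
theorem hasGrad_blockTensor {h A B C D f : Phase → ℝ} {gh gA gB gC gD gf z : Phase}
    (hh : HasGrad h gh z) (hA : HasGrad A gA z) (hB : HasGrad B gB z) (hC : HasGrad C gC z)
    (hD : HasGrad D gD z) (hf : HasGrad f gf z) (i j : Fin 4) :
    HasGrad (fun w => blockTensor (h w) (A w) (B w) (C w) (D w) (f w) i j)
      (fun m => blockTensor (gh m) (gA m) (gB m) (gC m) (gD m) (gf m) i j) z := by
  fin_cases i <;> fin_cases j <;> simp only [blockTensor, Matrix.of_apply, Matrix.cons_val',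
    Matrix.cons_val_zero, Matrix.cons_val_one, Matrix.cons_val, Fin.zero_eta, Fin.mk_one,
    Fin.reduceFinMk] <;>
    first
    | exact hasGrad_const 0 z
    | assumption
    | exact HasGrad.neg ‹_›

theorem blockTensor_skew (h A B C D f : ℝ) (i j : Fin 4) :
    blockTensor h A B C D f i j = - blockTensor h A B C D f j i := by
  fin_cases i <;> fin_cases j <;> simp [blockTensor]

theorem contDiffOn_blockTensor {M : Set Phase} {h A B C D f : Phase → ℝ}
    (hh : ContDiffOn ℝ ∞ h M) (hA : ContDiffOn ℝ ∞ A M) (hB : ContDiffOn ℝ ∞ B M)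
    (hC : ContDiffOn ℝ ∞ C M) (hD : ContDiffOn ℝ ∞ D M) (hf : ContDiffOn ℝ ∞ f M) (i j : Fin 4) :
    ContDiffOn ℝ ∞ (fun w => blockTensor (h w) (A w) (B w) (C w) (D w) (f w) i j) M := by
  fin_cases i <;> fin_cases j <;> simp only [blockTensor, Matrix.of_apply, Matrix.cons_val',
    Matrix.cons_val_zero, Matrix.cons_val_one, Matrix.cons_val, Fin.zero_eta, Fin.mk_one,
    Fin.reduceFinMk] <;>
    first
    | exact contDiffOn_const
    | assumption
    | exact ContDiffOn.neg ‹_›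

theorem linTensor_eq_blockTensor (c : Fin 8 → ℝ) (h f : ℝ × ℝ → ℝ) (z : Phase) :
    linTensor c h f z = blockTensor (h (qpart z)) (c 0 * z 2 + c 1 * z 3) (c 2 * z 2 + c 3 * z 3)
      (c 4 * z 2 + c 5 * z 3) (c 6 * z 2 + c 7 * z 3) (f (qpart z)) := rfl

theorem todaTensor_eq_blockTensor (a b : ℝ) (z : Phase) :
    todaTensor a b z
      = blockTensor a (z 2) 0 0 (z 3) (b * Real.exp ((z 1 - z 0) / a)) := by
  simp [todaTensor, blockTensor]

theorem transpose_mulVec_blockTensor (h A B C D f : ℝ) (v : Fin 4 → ℝ) :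
    (blockTensor h A B C D f * canP⁻¹).transpose.mulVec v
      = ![A * v 0 + C * v 1 - f * v 3, B * v 0 + D * v 1 + f * v 2,
          h * v 1 + A * v 2 + B * v 3, -h * v 0 + C * v 2 + D * v 3] := by
  rw [blockTensor_mul_inv]
  ext i
  fin_cases i <;> simp [Matrix.mulVec, dotProduct, Fin.sum_univ_four] <;> ring

/-! ### The open Toda lattice is a nontrivial solution -/

theorem eigenvalues_blockTensor {P' : Phase → Matrix (Fin 4) (Fin 4) ℝ} {z : Phase}
    {h A B C D f : ℝ} (hP : P' z = blockTensor h A B C D f) :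
    eigenvalues P' z
      = {l : ℂ | l ^ 2 - ((A + D : ℝ) : ℂ) * l - ((B * C + h * f - A * D : ℝ) : ℂ) = 0} := by
  ext l
  rw [eigenvalues, recOp, hP, mem_spectrum_blockTensor]; rfl

theorem mem_semisimpleLocus_blockTensor {P' : Phase → Matrix (Fin 4) (Fin 4) ℝ} {z : Phase}
    {h A B C D f : ℝ} (hP : P' z = blockTensor h A B C D f) :
    z ∈ semisimpleLocus P' ↔ (A + D) ^ 2 + 4 * (B * C + h * f - A * D) ≠ 0 := by
  rw [semisimpleLocus, Set.mem_ofPred_eq, eigenvalues_blockTensor hP, quadratic_roots_ncard]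

/-- The exponential of the Toda potential. -/
noncomputable def todaExp (a : ℝ) (z : Phase) : ℝ := Real.exp ((z 1 - z 0) / a)

/-- The discriminant of the minimal polynomial of the Toda recursion operator. -/
noncomputable def todaDisc (a b : ℝ) (z : Phase) : ℝ :=
  (z 2 - z 3) ^ 2 + 4 * (a * b * todaExp a z)

theorem hasGrad_todaExp (a : ℝ) (z : Phase) :
    HasGrad (todaExp a) ![-(todaExp a z / a), todaExp a z / a, 0, 0] z := by
  have := (((hasGrad_coord 1 z).sub (hasGrad_coord 0 z)).const_mul a⁻¹).exp
  refine (this.congr_of_eventuallyEq (.of_forall fun w => ?_)).congr_grad fun i => ?_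
  · simp [todaExp, div_eq_inv_mul]
  · fin_cases i <;> simp [todaExp, div_eq_inv_mul] <;> ring

theorem contDiff_todaExp (a : ℝ) : ContDiff ℝ ∞ (todaExp a) := by
  unfold todaExp; fun_prop

theorem hasGrad_natHam_toda {a : ℝ} (ha : a ≠ 0) (b : ℝ) (z : Phase) :
    HasGrad (natHam (todaV a b))
      ![-(2 * b * todaExp a z), 2 * b * todaExp a z, 2 * z 2, 2 * z 3] z := by
  have := (((hasGrad_coord 2 z).pow 2).add ((hasGrad_coord 3 z).pow 2)).add
    ((hasGrad_todaExp a z).const_mul (2 * a * b))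
  refine this.congr_grad fun i => ?_
  fin_cases i <;> simp <;> field_simp

theorem hasGrad_todaH₂ {a : ℝ} (ha : a ≠ 0) (b : ℝ) (z : Phase) :
    HasGrad (todaH₂ a b)
      ![-((z 2 + z 3) * (2 * b * todaExp a z)), (z 2 + z 3) * (2 * b * todaExp a z),
        2 * a * b * todaExp a z - 2 * z 2 * z 3 + (z 2 + z 3) * (2 * z 2),
        2 * a * b * todaExp a z - 2 * z 2 * z 3 + (z 2 + z 3) * (2 * z 3)] z := by
  have hs := (hasGrad_coord 2 z).add (hasGrad_coord 3 z)
  have := (hs.mul (hasGrad_natHam_toda ha b z)).sub ((hs.pow 3).const_mul (1 / 3))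
  refine (this.congr_of_eventuallyEq (.of_forall fun w => ?_)).congr_grad fun i => ?_
  · simp [todaH₂]; ring
  · fin_cases i <;> simp [natHam, todaV, todaExp, qpart] <;> ring

theorem hasGrad_todaDisc {a : ℝ} (ha : a ≠ 0) (b : ℝ) (z : Phase) :
    HasGrad (todaDisc a b) ![-(4 * b * todaExp a z), 4 * b * todaExp a z,
      2 * (z 2 - z 3), -(2 * (z 2 - z 3))] z := by
  have := (((hasGrad_coord 2 z).sub (hasGrad_coord 3 z)).pow 2).add
    (((hasGrad_todaExp a z).const_mul (a * b)).const_mul 4)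
  refine this.congr_grad fun i => ?_
  fin_cases i <;> simp <;> field_simp

theorem contDiff_todaDisc (a b : ℝ) : ContDiff ℝ ∞ (todaDisc a b) := by
  have := contDiff_todaExp a
  unfold todaDisc; fun_prop

theorem todaExp_pos (a : ℝ) (z : Phase) : 0 < todaExp a z := Real.exp_pos _

theorem mem_semisimpleLocus_toda (a b : ℝ) (z : Phase) :
    z ∈ semisimpleLocus (todaTensor a b) ↔ todaDisc a b z ≠ 0 := by
  rw [mem_semisimpleLocus_blockTensor (todaTensor_eq_blockTensor a b z), todaDisc, todaExp]
  ring_nf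

theorem isOpen_semisimpleLocus_toda (a b : ℝ) : IsOpen (semisimpleLocus (todaTensor a b)) := by
  have : semisimpleLocus (todaTensor a b) = todaDisc a b ⁻¹' {0}ᶜ := by
    ext z; exact mem_semisimpleLocus_toda a b z
  rw [this]
  exact isOpen_compl_singleton.preimage (contDiff_todaDisc a b).continuous

theorem dense_semisimpleLocus_toda {a b : ℝ} (ha : a ≠ 0) (hb : b ≠ 0) :
    Dense (semisimpleLocus (todaTensor a b)) := by
  intro z
  have := subset_closure_ne_zero isOpen_univ (F := todaDisc a b) (m := 0) (fun w _ => by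
    rw [(hasGrad_todaDisc ha b w).pd]
    simpa using ⟨hb, (todaExp_pos a w).ne'⟩) (Set.mem_univ z)
  refine closure_mono ?_ this
  rintro w ⟨-, hw⟩
  exact (mem_semisimpleLocus_toda a b w).2 hw

theorem semisimpleLocus_toda_of_pos {a b : ℝ} (hab : 0 < a * b) :
    semisimpleLocus (todaTensor a b) = Set.univ := by
  refine Set.eq_univ_of_forall fun z => (mem_semisimpleLocus_toda a b z).2 (ne_of_gt ?_)
  have := mul_pos hab (todaExp_pos a z)
  unfold todaDisc; positivity

/-- Two parameters cover both P' (s = 0, t = 1) and P + tP' (s = 1). -/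
theorem isPoissonOn_toda_pencil {a : ℝ} (ha : a ≠ 0) (b s t : ℝ) (M : Set Phase) :
    IsPoissonOn M (fun z => s • canP + t • todaTensor a b z) := by
  have he : (fun z => s • canP + t • todaTensor a b z) = fun z =>
      blockTensor (t * a) (s + t * z 2) 0 0 (s + t * z 3) (t * (b * todaExp a z)) := by
    funext z
    ext i j
    fin_cases i <;> fin_cases j <;>
      simp [canP, todaTensor_eq_blockTensor, blockTensor, todaExp] <;> ring
  rw [he]
  have hg : ∀ z i j, HasGrad (fun z : Phase =>
      blockTensor (t * a) (s + t * z 2) 0 0 (s + t * z 3) (t * (b * todaExp a z)) i j)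
      (fun m => blockTensor 0 ((![0, 0, t, 0] : Phase) m) 0 0 ((![0, 0, 0, t] : Phase) m)
        (t * b * (![-(todaExp a z / a), todaExp a z / a, 0, 0] : Phase) m) i j) z := by
    intro z i j
    refine hasGrad_blockTensor (hasGrad_const _ z) ?_ (hasGrad_const 0 z) (hasGrad_const 0 z) ?_
      ?_ i j
    · refine ((hasGrad_const s z).add ((hasGrad_coord 2 z).const_mul t)).congr_grad fun i => ?_
      fin_cases i <;> simp
    · refine ((hasGrad_const s z).add ((hasGrad_coord 3 z).const_mul t)).congr_grad fun i => ?_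
      fin_cases i <;> simp
    · exact (((hasGrad_todaExp a z).const_mul b).const_mul t).congr_grad fun i => by ring
  refine ⟨fun i j => ?_, fun z _ i j => blockTensor_skew _ _ _ _ _ _ i j, fun z _ i j k => ?_⟩
  · have := contDiff_todaExp a
    exact contDiffOn_blockTensor contDiffOn_const (by fun_prop) contDiffOn_const
      contDiffOn_const (by fun_prop) (by fun_prop) i j
  · simp only [(hg z _ _).pd]
    fin_cases i <;> fin_cases j <;> fin_cases k <;>
      simp [Fin.sum_univ_four, blockTensor] <;> field_simp <;> ring

theorem lenardMagriOn_toda {a : ℝ} (ha : a ≠ 0) (b : ℝ) (M : Set Phase) :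
    LenardMagriOn M (todaTensor a b) (natHam (todaV a b)) (todaH₂ a b) := by
  intro z _
  refine ⟨_, _, by
    rw [recOp, todaTensor_eq_blockTensor]; exact charpoly_blockTensor _ _ _ _ _ _, fun j => ?_⟩
  rw [recOp, todaTensor_eq_blockTensor, transpose_mulVec_blockTensor]
  have h1 := (hasGrad_natHam_toda ha b z).grad
  have h2 := (hasGrad_todaH₂ ha b z).grad
  rw [show Real.exp ((z 1 - z 0) / a) = todaExp a z from rfl]
  fin_cases j <;> ext i <;> fin_cases i <;> simp [h1, h2, controlMatrix] <;> ring

theorem contDiff_todaV (a b : ℝ) : ContDiff ℝ ∞ (todaV a b) := by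
  unfold todaV; fun_prop

theorem contDiff_todaH₂ (a b : ℝ) : ContDiff ℝ ∞ (todaH₂ a b) := by
  have := contDiff_todaV a b
  have hq : ContDiff ℝ ∞ qpart := by unfold qpart; fun_prop
  unfold todaH₂ natHam; fun_prop

/-- One has dH₂ = (p₁ + p₂) dH₁ + 2(ab e^((q₂-q₁)/a) - p₁p₂)(dp₁ + dp₂), and dH₁ has a nonzero
q₁-component. So the differentials are independent wherever the bracketed factor is nonzero. That
set is dense because the q₁-derivative of the factor never vanishes. -/
theorem independent_toda {a b : ℝ} (ha : a ≠ 0) (hb : b ≠ 0) {M : Set Phase} (hM : IsOpen M) :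
    FunctionallyIndependentOn ℝ M (natHam (todaV a b)) (todaH₂ a b) := by
  have hg : ∀ z : Phase, HasGrad (fun w : Phase => a * b * todaExp a w - w 2 * w 3)
      ![-(b * todaExp a z), b * todaExp a z, -z 3, -z 2] z := by
    intro z
    refine (((hasGrad_todaExp a z).const_mul (a * b)).sub
      ((hasGrad_coord 2 z).mul (hasGrad_coord 3 z))).congr_grad fun i => ?_
    fin_cases i <;> simp <;> field_simp
  refine (subset_closure_ne_zero hM (m := 0) (fun w _ => by
    rw [(hg w).pd]; simpa using ⟨hb, (todaExp_pos a w).ne'⟩)).trans (closure_mono ?_)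
  rintro z ⟨hz, h0⟩
  refine ⟨hz, ?_⟩
  have hE := (todaExp_pos a z).ne'
  rw [HasFDerivAt.fderiv (hasGrad_natHam_toda ha b z), HasFDerivAt.fderiv (hasGrad_todaH₂ ha b z),
    LinearIndependent.pair_iff]
  intro r s h
  have e0 := congrArg (fun l : Phase →L[ℝ] ℝ => l (Pi.single 0 1)) h
  have e2 := congrArg (fun l : Phase →L[ℝ] ℝ => l (Pi.single 2 1)) h
  simp [gradForm_single] at e0 e2
  have e0' : r + s * (z 2 + z 3) = 0 := by
    have : (b * todaExp a z) * (r + s * (z 2 + z 3)) = 0 := by linear_combination -e0 / 2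
    exact (mul_eq_zero.1 this).resolve_left (mul_ne_zero hb hE)
  have hs : s = 0 := by
    have : (a * b * todaExp a z - z 2 * z 3) * s = 0 := by
      linear_combination e2 / 2 - z 2 * e0'
    exact (mul_eq_zero.1 this).resolve_left h0
  exact ⟨by simpa [hs] using e0', hs⟩

/-- A nowhere vanishing smooth real function has locally a smooth complex square root. -/
theorem exists_local_sqrt {F : Phase → ℝ} (hF : ContDiff ℝ ∞ F) {z : Phase} (hz : F z ≠ 0) :
    ∃ r : Phase → ℂ, ContDiffOn ℝ ∞ r {w | 0 < F z * F w} ∧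
      ∀ w ∈ {w | 0 < F z * F w}, r w ^ 2 = F w := by
  rcases lt_or_gt_of_ne hz with h | h
  · have hneg : ∀ w ∈ {w | 0 < F z * F w}, 0 < -F w := fun w hw => by
      have := (mul_pos_iff.1 hw).resolve_left (fun h' => h'.1.not_gt h)
      linarith [this.2]
    refine ⟨fun w => Complex.I * (Real.sqrt (-F w) : ℝ), ?_, fun w hw => ?_⟩
    · refine contDiffOn_const.mul (Complex.ofRealCLM.contDiff.comp_contDiffOn ?_)
      exact hF.neg.contDiffOn.sqrt fun w hw => (hneg w hw).ne'
    · rw [mul_pow, Complex.I_sq, ← Complex.ofReal_pow, Real.sq_sqrt (hneg w hw).le]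
      push_cast; ring
  · have hpos : ∀ w ∈ {w | 0 < F z * F w}, 0 < F w := fun w hw =>
      (pos_iff_pos_of_mul_pos hw).1 h
    refine ⟨fun w => (Real.sqrt (F w) : ℝ), ?_, fun w hw => ?_⟩
    · refine Complex.ofRealCLM.contDiff.comp_contDiffOn ?_
      exact hF.contDiffOn.sqrt fun w hw => (hpos w hw).ne'
    · rw [← Complex.ofReal_pow, Real.sq_sqrt (hpos w hw).le]

/-- The eigenvalues are (p₁ + p₂ ± r)/2 with r a local square root of the discriminant.
Differentiating r² shows ∂r/∂q₁ ≠ 0, while p₁ + p₂ does not depend on q₁. Comparing the q₁- and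
p₁-components therefore proves independence at every point. -/
theorem regularOn_toda {a b : ℝ} (ha : a ≠ 0) (hb : b ≠ 0) {M : Set Phase} (hM : IsOpen M)
    (hss : M ⊆ semisimpleLocus (todaTensor a b)) : RegularOn M (todaTensor a b) := by
  intro z hz
  have hdz : todaDisc a b z ≠ 0 := (mem_semisimpleLocus_toda a b z).1 (hss hz)
  obtain ⟨r, hr, hr2⟩ := exists_local_sqrt (contDiff_todaDisc a b) hdz
  have hopen : IsOpen {w | 0 < todaDisc a b z * todaDisc a b w} :=
    isOpen_lt continuous_const (continuous_const.mul (contDiff_todaDisc a b).continuous)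
  set S := {w | 0 < todaDisc a b z * todaDisc a b w}
  have hr' : ContDiffOn ℝ ∞ r (M ∩ S) := hr.mono Set.inter_subset_right
  have hs : ContDiff ℝ ∞ (fun w : Phase => ((w 2 + w 3 : ℝ) : ℂ)) :=
    Complex.ofRealCLM.contDiff.comp
      (show ContDiff ℝ ∞ (fun w : Phase => w 2 + w 3) by fun_prop)
  refine ⟨M ∩ S, hM.inter hopen, ⟨hz, mul_self_pos.2 hdz⟩, Set.inter_subset_left,
    fun w => 2⁻¹ * (((w 2 + w 3 : ℝ) : ℂ) + r w), fun w => 2⁻¹ * (((w 2 + w 3 : ℝ) : ℂ) - r w),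
    contDiffOn_const.mul (hs.contDiffOn.add hr'), contDiffOn_const.mul (hs.contDiffOn.sub hr'),
    fun w hw => ?_, fun w hw => subset_closure ⟨hw, ?_⟩⟩
  · have hw2 := hr2 w hw.2
    have hd : todaDisc a b w ≠ 0 := fun h0 => by
      have : 0 < todaDisc a b z * todaDisc a b w := hw.2
      simp [h0] at this
    have hr0 : r w ≠ 0 := fun h0 => by
      rw [h0] at hw2; simp at hw2; exact hd (by exact_mod_cast hw2.symm)
    rw [eigenvalues_blockTensor (todaTensor_eq_blockTensor a b w)]
    refine (quadratic_roots_eq_pair fun h => hr0 ?_).2 ⟨?_, ?_⟩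
    · linear_combination h
    · push_cast; ring
    · have : ((todaDisc a b w : ℝ) : ℂ) = _ := congrArg Complex.ofReal (todaDisc.eq_1 a b w)
      rw [this, todaExp] at hw2
      push_cast at hw2 ⊢
      linear_combination -hw2 / 4
  · have hwn : M ∩ S ∈ 𝓝 w := (hM.inter hopen).mem_nhds hw
    have hrd : HasFDerivAt r (fderiv ℝ r w) w :=
      ((hr'.contDiffAt hwn).differentiableAt (by simp)).hasFDerivAt
    have hsd : HasFDerivAt (fun w : Phase => ((w 2 + w 3 : ℝ) : ℂ))
        (Complex.ofRealCLM.comp (gradForm ![0, 0, 1, 1])) w := by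
      refine Complex.ofRealCLM.hasFDerivAt.comp w ?_
      refine ((hasGrad_coord 2 w).add (hasGrad_coord 3 w)).congr_grad fun i => ?_
      fin_cases i <;> simp
    have hdd : HasFDerivAt (fun w : Phase => ((todaDisc a b w : ℝ) : ℂ))
        (Complex.ofRealCLM.comp (gradForm ![-(4 * b * todaExp a w), 4 * b * todaExp a w,
      2 * (w 2 - w 3), -(2 * (w 2 - w 3))])) w :=
      Complex.ofRealCLM.hasFDerivAt.comp w (hasGrad_todaDisc ha b w)
    have hsq : HasFDerivAt (fun w : Phase => ((todaDisc a b w : ℝ) : ℂ))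
        (r w • fderiv ℝ r w + r w • fderiv ℝ r w) w := by
      refine (hrd.mul hrd).congr_of_eventuallyEq ?_
      filter_upwards [hwn] with u hu
      rw [← hr2 u hu.2, sq]; rfl
    have hr0 : (2 : ℂ) * (r w * fderiv ℝ r w (Pi.single 0 1))
        = ((-(4 * b * todaExp a w) : ℝ) : ℂ) := by
      have := congrArg (fun l : Phase →L[ℝ] ℂ => l (Pi.single 0 1)) (hsq.unique hdd)
      simp [gradForm_single] at this
      push_cast
      linear_combination this
    have hr0' : fderiv ℝ r w (Pi.single 0 1) ≠ 0 := fun h0 => by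
      rw [h0] at hr0
      simp at hr0
      exact hr0.elim hb fun h => (todaExp_pos a w).ne' h
    have hl1 := ((hasFDerivAt_const (2⁻¹ : ℂ) w).mul (hsd.add hrd)).fderiv
    have hl2 := ((hasFDerivAt_const (2⁻¹ : ℂ) w).mul (hsd.sub hrd)).fderiv
    have hl1' : fderiv ℝ (fun w => 2⁻¹ * (((w 2 + w 3 : ℝ) : ℂ) + r w)) w = _ := hl1
    have hl2' : fderiv ℝ (fun w => 2⁻¹ * (((w 2 + w 3 : ℝ) : ℂ) - r w)) w = _ := hl2
    rw [hl1', hl2', LinearIndependent.pair_iff]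
    intro s t h
    have e0 := congrArg (fun l : Phase →L[ℝ] ℂ => l (Pi.single 0 1)) h
    have e2 := congrArg (fun l : Phase →L[ℝ] ℂ => l (Pi.single 2 1)) h
    simp [gradForm_single] at e0 e2
    have hst : s - t = 0 := by
      have : (s - t) * fderiv ℝ r w (Pi.single 0 1) = 0 := by linear_combination 2 * e0
      exact (mul_eq_zero.1 this).resolve_right hr0'
    have hst' : s + t = 0 := by
      linear_combination 2 * e2 - (fderiv ℝ r w (Pi.single 2 1)) * hst
    constructor
    · linear_combination (hst + hst') / 2
    · linear_combination (hst' - hst) / 2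

theorem isNontrivialSolution_toda {a b : ℝ} (ha : a ≠ 0) (hb : b ≠ 0) {M : Set Phase}
    (hM : IsOpen M) (hne : M.Nonempty) (hss : M ⊆ semisimpleLocus (todaTensor a b)) :
    IsNontrivialSolution M (todaTensor a b) (todaV a b) (todaH₂ a b) := by
  have hV0 : ∀ z : Phase, pd 0 (natHam (todaV a b)) z ≠ 0 := fun z => by
    rw [(hasGrad_natHam_toda ha b z).pd]
    simpa using ⟨hb, (todaExp_pos a z).ne'⟩
  obtain ⟨z, hz⟩ := hne
  have hind := independent_toda ha hb hM
  refine ⟨(contDiff_todaV a b).contDiffOn, (contDiff_todaH₂ a b).contDiffOn, ?_, fun t => ?_,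
    lenardMagriOn_toda ha b M, hss, regularOn_toda ha hb hM hss, fun w _ => ?_, fun w _ => ?_,
    hind, ⟨z, hz, fun h => hV0 z ?_⟩, ?_, ?_⟩
  · simpa using isPoissonOn_toda_pencil ha b 0 1 M
  · simpa using isPoissonOn_toda_pencil ha b 1 t M
  · simp only [bracket, (hasGrad_natHam_toda ha b w).pd, (hasGrad_todaH₂ ha b w).pd]
    simp [Fin.sum_univ_four, canP]; ring
  · simp only [bracket, (hasGrad_natHam_toda ha b w).pd, (hasGrad_todaH₂ ha b w).pd,
      todaTensor_eq_blockTensor]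
    rw [show Real.exp ((w 1 - w 0) / a) = todaExp a w from rfl]
    simp [Fin.sum_univ_four, blockTensor]; ring
  · rw [pd, h]; rfl
  · obtain ⟨w, hw, hli⟩ := closure_nonempty_iff.1 ⟨z, hind hz⟩
    exact ⟨w, hw, by simpa using hli.ne_zero 1⟩
  · by_contra! hcon
    have hg : HasGrad (fun w => todaV a b (qpart w)) 0 z :=
      (hasGrad_const (todaV a b (qpart z)) z).congr_of_eventuallyEq
        (by filter_upwards [hM.mem_nhds hz] with w hw using hcon w hw z hz)
    have hg' := (((hasGrad_coord 2 z).pow 2).add ((hasGrad_coord 3 z).pow 2)).add hg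
    have hg'' : HasGrad (natHam (todaV a b)) _ z := hg'
    apply hV0 z
    rw [hg''.pd]; simp

/-! ### Local canonical transformations -/

theorem fderiv_eq_jacobian_mulVec {φ : Phase → Phase} {z : Phase} (h : DifferentiableAt ℝ φ z)
    (v : Phase) : fderiv ℝ φ z v = (jacobian φ z).mulVec v := by
  ext i
  have hi : HasGrad (fun w => φ w i) (grad (fun w => φ w i) z) z :=
    hasGrad_of_differentiableAt (differentiableAt_pi.1 h i)
  have h1 : HasFDerivAt (fun w => φ w i)
      ((ContinuousLinearMap.proj (R := ℝ) (φ := fun _ : Fin 4 => ℝ) i).comp (fderiv ℝ φ z)) z :=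
    HasFDerivAt.comp (g := fun y : Phase => y i) z (hasFDerivAt_apply i (φ z)) h.hasFDerivAt
  have h2 := congrArg (fun l : Phase →L[ℝ] ℝ => l v) (h1.unique hi)
  simp only [ContinuousLinearMap.comp_apply, ContinuousLinearMap.proj_apply, gradForm_apply] at h2
  rw [h2]; rfl

/-- A smooth map whose Jacobi matrix has trivial kernel is locally injective. -/
theorem exists_injOn_nhds {φ : Phase → Phase} {z : Phase} (h : ContDiffAt ℝ ∞ φ z)
    (hJ : ∀ v, (jacobian φ z).mulVec v = 0 → v = 0) : ∃ U ∈ 𝓝 z, Set.InjOn φ U := by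
  have hd : DifferentiableAt ℝ φ z := h.differentiableAt (by simp)
  have hinj : Function.Injective (fderiv ℝ φ z : Phase →ₗ[ℝ] Phase) :=
    (injective_iff_map_eq_zero _).2 fun v hv => hJ v (by
      rw [← fderiv_eq_jacobian_mulVec hd]; exact hv)
  let e : Phase ≃L[ℝ] Phase :=
    (LinearEquiv.ofInjectiveEndo _ hinj).toContinuousLinearEquiv
  have he : HasFDerivAt φ (e : Phase →L[ℝ] Phase) z := by
    have : (e : Phase →L[ℝ] Phase) = fderiv ℝ φ z := by ext v; rfl
    rw [this]; exact hd.hasFDerivAt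
  have hs := h.hasStrictFDerivAt' he (by simp)
  refine ⟨_, (hs.toOpenPartialHomeomorph φ).open_source.mem_nhds
    hs.mem_toOpenPartialHomeomorph_source, ?_⟩
  have := (hs.toOpenPartialHomeomorph φ).injOn
  rwa [hs.toOpenPartialHomeomorph_coe] at this

/-- The relation exhibits P Jᵀ (-P) as a right inverse of the square matrix J, hence as a left
inverse too. -/
theorem mulVec_eq_zero_of_canonical {J : Matrix (Fin 4) (Fin 4) ℝ}
    (hJ : J * canP * J.transpose = canP) {v : Fin 4 → ℝ} (hv : J.mulVec v = 0) : v = 0 := by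
  have h1 : J * (canP * J.transpose * -canP) = 1 := by
    rw [← Matrix.mul_assoc, ← Matrix.mul_assoc, hJ, canP_mul_neg]
  have h2 := mul_eq_one_comm.1 h1
  rw [← Matrix.one_mulVec v, ← h2, ← Matrix.mulVec_mulVec, hv, Matrix.mulVec_zero]

/-- A smooth map that satisfies `J P Jᵀ = P` near a point restricts to a canonical transformation
of a neighbourhood of this point. -/
theorem exists_isCanonicalOn {M : Set Phase} {z : Phase} (hM : M ∈ 𝓝 z) {φ : Phase → Phase}
    {J : Phase → Matrix (Fin 4) (Fin 4) ℝ} {Q : Phase → Matrix (Fin 4) (Fin 4) ℝ → Prop}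
    (h : ∀ᶠ w in 𝓝 z, ContDiffAt ℝ ∞ φ w ∧ (∀ i, HasGrad (fun u => φ u i) (J w i) w) ∧
      J w * canP * (J w).transpose = canP ∧ Q w (J w)) :
    ∃ W : Set Phase, IsOpen W ∧ z ∈ W ∧ W ⊆ M ∧ IsCanonicalOn W φ ∧
      ∀ w ∈ W, Q w (jacobian φ w) := by
  have hz := h.self_of_nhds
  obtain ⟨U, hU, hinj⟩ := exists_injOn_nhds hz.1 fun v hv => by
    rw [jacobian_eq_of_hasGrad hz.2.1] at hv
    exact mulVec_eq_zero_of_canonical hz.2.2.1 hv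
  obtain ⟨W, hWs, hWo, hzW⟩ := mem_nhds_iff.1 (inter_mem (inter_mem hM hU) h)
  refine ⟨W, hWo, hzW, fun w hw => (hWs hw).1.1, ⟨fun w hw => (hWs hw).2.1.contDiffWithinAt,
    hinj.mono fun w hw => (hWs hw).1.2, fun w hw => ?_⟩, fun w hw => ?_⟩
  · rw [jacobian_eq_of_hasGrad (hWs hw).2.2.1]; exact (hWs hw).2.2.2.1
  · rw [jacobian_eq_of_hasGrad (hWs hw).2.2.1]; exact (hWs hw).2.2.2.2

/-- The chain rule for an affine change of coordinates. -/
theorem HasGrad.comp_affine {F : Phase → ℝ} {g z : Phase} (R : Matrix (Fin 4) (Fin 4) ℝ)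
    (s : Phase) (hF : HasGrad F g (R.mulVec z + s)) :
    HasGrad (fun w => F (R.mulVec w + s)) (Matrix.vecMul g R) z := by
  have h1 : HasFDerivAt (fun w : Phase => R.mulVec w + s)
      (LinearMap.toContinuousLinearMap R.mulVecLin) z :=
    ((LinearMap.toContinuousLinearMap R.mulVecLin).hasFDerivAt).add_const s
  have h2 : gradForm (Matrix.vecMul g R)
      = (gradForm g).comp (LinearMap.toContinuousLinearMap R.mulVecLin) := by
    refine ContinuousLinearMap.ext fun v => ?_
    have := (Matrix.dotProduct_mulVec g R v).symm
    simpa [gradForm_apply, dotProduct] using this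
  rw [HasGrad, h2]
  exact HasFDerivAt.comp z hF h1

theorem contDiff_affine (R : Matrix (Fin 4) (Fin 4) ℝ) (s : Phase) :
    ContDiff ℝ ∞ (fun w : Phase => R.mulVec w + s) :=
  ((LinearMap.toContinuousLinearMap R.mulVecLin).contDiff).add contDiff_const

/-! ### The canonical transformation from the inverse square potential to the Toda lattice -/

/-- The functions `L = log (cosh (√W t) / √W)` and `G = ∂L/∂t`. -/
theorem exists_riccati_pos {F t : Phase → ℝ} {z : Phase}
    (hF : ∀ᶠ w in 𝓝 z, ContDiffAt ℝ ∞ F w) (ht : ∀ᶠ w in 𝓝 z, ContDiffAt ℝ ∞ t w)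
    (h0 : 0 < F z) : ∃ L G : Phase → ℝ, ∀ᶠ w in 𝓝 z,
      ContDiffAt ℝ ∞ L w ∧ ContDiffAt ℝ ∞ G w ∧ F w ≠ 0 ∧
      HasGrad L (fun i => (t w * G w - 1) / (2 * F w) * grad F w i + G w * grad t w i) w ∧
      HasGrad G (fun i => (G w + t w * (F w - G w ^ 2)) / (2 * F w) * grad F w i
        + (F w - G w ^ 2) * grad t w i) w ∧
      Real.exp (-(2 * L w)) = F w - G w ^ 2 := by
  -- As functions of t these satisfy L' = G and G' = F - G², and F - G² = F / cosh². This is the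
  -- relative Toda motion, with exp(-2L) as the exponential of the potential.
  refine ⟨fun w => Real.log (Real.cosh (√(F w) * t w)) - Real.log (√(F w)),
    fun w => √(F w) * (Real.sinh (√(F w) * t w) * (Real.cosh (√(F w) * t w))⁻¹), ?_⟩
  filter_upwards [hF, ht, hF.self_of_nhds.continuousAt.eventually (lt_mem_nhds h0)]
    with w hFw htw hpos
  have hs0 : √(F w) ≠ 0 := (Real.sqrt_pos.2 hpos).ne'
  have hs2 : F w = √(F w) ^ 2 := (Real.sq_sqrt hpos.le).symm
  have hc0 : Real.cosh (√(F w) * t w) ≠ 0 := (Real.cosh_pos _).ne'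
  have hcs := Real.cosh_sq (√(F w) * t w)
  have hsc : ContDiffAt ℝ ∞ (fun w => √(F w)) w := hFw.sqrt hpos.ne'
  have hstc := hsc.mul htw
  have gF := hasGrad_of_differentiableAt (hFw.differentiableAt (by simp))
  have gt := hasGrad_of_differentiableAt (htw.differentiableAt (by simp))
  have gs := gF.scomp (Real.hasDerivAt_sqrt hpos.ne')
  have gst := gs.mul gt
  have gc := gst.scomp (Real.hasDerivAt_cosh _)
  have gsh := gst.scomp (Real.hasDerivAt_sinh _)
  have hcc : ContDiffAt ℝ ∞ (fun w => Real.cosh (√(F w) * t w)) w := hstc.cosh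
  have hshc : ContDiffAt ℝ ∞ (fun w => Real.sinh (√(F w) * t w)) w := hstc.sinh
  refine ⟨(hcc.log hc0).sub (hsc.log hs0), hsc.mul (hshc.mul (hcc.inv hc0)), hpos.ne',
    ((gc.log hc0).sub (gs.log hs0)).congr_grad fun i => ?_,
    (gs.mul (gsh.mul (gc.inv hc0))).congr_grad fun i => ?_, ?_⟩
  · generalize Real.cosh (√(F w) * t w) = c at *
    generalize Real.sinh (√(F w) * t w) = s at *
    generalize √(F w) = r at *
    rw [hs2]
    field_simp
    ring
  · generalize Real.cosh (√(F w) * t w) = c at *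
    generalize Real.sinh (√(F w) * t w) = s at *
    generalize √(F w) = r at *
    rw [hs2]
    field_simp
    ring
  · have : -(2 * (Real.log (Real.cosh (√(F w) * t w)) - Real.log √(F w)))
        = Real.log ((√(F w) / Real.cosh (√(F w) * t w)) ^ 2) := by
      rw [Real.log_pow, Real.log_div hs0 hc0]; push_cast; ring
    rw [this, Real.exp_log (by positivity)]
    generalize Real.cosh (√(F w) * t w) = c at *
    generalize Real.sinh (√(F w) * t w) = s at *
    generalize √(F w) = r at *
    rw [hs2]
    field_simp
    linear_combination -hcs

/-- The functions `L = log (cos (√(-W) t + θ) / √(-W))` and `G = ∂L/∂t`. -/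
theorem exists_riccati_neg {F t : Phase → ℝ} {z : Phase}
    (hF : ∀ᶠ w in 𝓝 z, ContDiffAt ℝ ∞ F w) (ht : ∀ᶠ w in 𝓝 z, ContDiffAt ℝ ∞ t w)
    (h0 : F z < 0) : ∃ L G : Phase → ℝ, ∀ᶠ w in 𝓝 z,
      ContDiffAt ℝ ∞ L w ∧ ContDiffAt ℝ ∞ G w ∧ F w ≠ 0 ∧
      HasGrad L (fun i => (t w * G w - 1) / (2 * F w) * grad F w i + G w * grad t w i) w ∧
      HasGrad G (fun i => (G w + t w * (F w - G w ^ 2)) / (2 * F w) * grad F w i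
        + (F w - G w ^ 2) * grad t w i) w ∧
      -Real.exp (-(2 * L w)) = F w - G w ^ 2 := by
  -- The phase makes the cosine equal to 1 at z, hence positive nearby. As a constant it does not
  -- affect the form of the differential identities.
  set θ := -(√(-F z) * t z) with hθ
  have hcz : Real.cos (√(-F z) * t z + θ) = 1 := by simp [hθ]
  have hcont : ContinuousAt (fun w => Real.cos (√(-F w) * t w + θ)) z := by
    have h1 := hF.self_of_nhds.continuousAt
    have h2 := ht.self_of_nhds.continuousAt
    fun_prop
  refine ⟨fun w => Real.log (Real.cos (√(-F w) * t w + θ)) - Real.log (√(-F w)),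
    fun w => -(√(-F w) * (Real.sin (√(-F w) * t w + θ) * (Real.cos (√(-F w) * t w + θ))⁻¹)), ?_⟩
  filter_upwards [hF, ht, hF.self_of_nhds.continuousAt.eventually (gt_mem_nhds h0),
    hcont.eventually (lt_mem_nhds (show (0 : ℝ) < Real.cos (√(-F z) * t z + θ) by rw [hcz]; exact one_pos))]
    with w hFw htw hneg hcpos
  have hpos : 0 < -F w := by linarith
  have hs0 : √(-F w) ≠ 0 := (Real.sqrt_pos.2 hpos).ne'
  have hs2 : F w = -√(-F w) ^ 2 := by rw [Real.sq_sqrt hpos.le]; ring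
  have hc0 : Real.cos (√(-F w) * t w + θ) ≠ 0 := hcpos.ne'
  have hcs := Real.sin_sq_add_cos_sq (√(-F w) * t w + θ)
  have hsc : ContDiffAt ℝ ∞ (fun w => √(-F w)) w := hFw.neg.sqrt hpos.ne'
  have hstc : ContDiffAt ℝ ∞ (fun w => √(-F w) * t w + θ) w :=
    (hsc.mul htw).add contDiffAt_const
  have gF := hasGrad_of_differentiableAt (hFw.differentiableAt (by simp))
  have gt := hasGrad_of_differentiableAt (htw.differentiableAt (by simp))
  have gs := gF.neg.scomp (Real.hasDerivAt_sqrt hpos.ne')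
  have gst := (gs.mul gt).add (hasGrad_const θ w)
  have gc := gst.scomp (Real.hasDerivAt_cos _)
  have gsh := gst.scomp (Real.hasDerivAt_sin _)
  have hcc : ContDiffAt ℝ ∞ (fun w => Real.cos (√(-F w) * t w + θ)) w := hstc.cos
  have hshc : ContDiffAt ℝ ∞ (fun w => Real.sin (√(-F w) * t w + θ)) w := hstc.sin
  have hnz : F w ≠ 0 := hneg.ne
  refine ⟨(hcc.log hc0).sub (hsc.log hs0), (hsc.mul (hshc.mul (hcc.inv hc0))).neg, hnz,
    ((gc.log hc0).sub (gs.log hs0)).congr_grad fun i => ?_,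
    (gs.mul (gsh.mul (gc.inv hc0))).neg.congr_grad fun i => ?_, ?_⟩
  · generalize Real.cos (√(-F w) * t w + θ) = c at *
    generalize Real.sin (√(-F w) * t w + θ) = s at *
    generalize √(-F w) = r at *
    rw [hs2]
    simp only [Pi.zero_apply]
    field_simp
    ring
  · generalize Real.cos (√(-F w) * t w + θ) = c at *
    generalize Real.sin (√(-F w) * t w + θ) = s at *
    generalize √(-F w) = r at *
    rw [hs2]
    simp only [Pi.zero_apply]
    field_simp
    ring
  · have : -(2 * (Real.log (Real.cos (√(-F w) * t w + θ)) - Real.log √(-F w)))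
        = Real.log ((√(-F w) / Real.cos (√(-F w) * t w + θ)) ^ 2) := by
      rw [Real.log_pow, Real.log_div hs0 hc0]; push_cast; ring
    rw [this, Real.exp_log (by positivity)]
    generalize Real.cos (√(-F w) * t w + θ) = c at *
    generalize Real.sin (√(-F w) * t w + θ) = s at *
    generalize √(-F w) = r at *
    rw [hs2]
    field_simp
    linear_combination hcs

/-- A time function of the inverse square potential: it is conjugate to the energy and
homogeneous of degree two with respect to the scaling symmetry. -/
theorem exists_time {κ : ℝ} (hκ : κ ≠ 0) {z : Phase} (hx : z 0 ≠ 0) :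
    ∃ t : Phase → ℝ, ∀ᶠ w in 𝓝 z, ContDiffAt ℝ ∞ t w ∧ w 0 ≠ 0 ∧ ∃ tx tp : ℝ,
      HasGrad t ![tx, 0, tp, 0] w ∧ w 2 * tx + κ / w 0 ^ 3 * tp = 1 ∧
      w 0 * tx - w 2 * tp = 2 * t w := by
  have hx' : ∀ᶠ w : Phase in 𝓝 z, w 0 ≠ 0 :=
    (continuous_apply 0).continuousAt.eventually_ne hx
  -- With x = z 0, p = z 2 and 2E = p² + κ/x², the derivative of xp along the motion is 2E, so t =
  -- xp/(2E) is a time function wherever E ≠ 0. The case split is on E = 0 at z.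
  by_cases hD : (z 0 * z 2) ^ 2 + κ = 0
  · have hc : z 0 * z 2 ≠ 0 := fun h => hκ (by simpa [h] using hD)
    set c := z 0 * z 2 with hcdef
    have hne : ∀ᶠ w : Phase in 𝓝 z, w 0 * w 2 + c ≠ 0 := by
      have : ContinuousAt (fun w : Phase => w 0 * w 2 + c) z := by fun_prop
      refine this.eventually_ne ?_
      rw [← hcdef]
      intro h
      exact hc (by linarith)
    -- At zero energy κ = -c², and (xp)² + κ = (xp - c)(xp + c). Subtracting c/(2E), a function of
    -- the energy with the same scaling weight, from xp/(2E) cancels the vanishing factor xp - c.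
    refine ⟨fun w => w 0 ^ 2 * (w 0 * w 2 + c)⁻¹, ?_⟩
    filter_upwards [hne, hx'] with w hw hxw
    have hs : ContDiffAt ℝ ∞ (fun w : Phase => w 0 * w 2 + c) w := by fun_prop
    have hs' : ContDiffAt ℝ ∞ (fun w : Phase => w 0 ^ 2) w := by fun_prop
    have g := ((hasGrad_coord 0 w).pow 2).mul
      ((((hasGrad_coord 0 w).mul (hasGrad_coord 2 w)).add (hasGrad_const c w)).inv hw)
    refine ⟨hs'.mul (hs.inv hw), hxw, (w 0 ^ 2 * w 2 + 2 * w 0 * c) / (w 0 * w 2 + c) ^ 2,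
      -(w 0 ^ 3) / (w 0 * w 2 + c) ^ 2, g.congr_grad fun i => ?_, ?_, ?_⟩
    · fin_cases i <;> simp <;> field_simp <;> ring
    · have hk : κ = -c ^ 2 := by linarith
      rw [hk]
      generalize hd : w 0 * w 2 + c = d at hw
      field_simp
      rw [← hd]; ring
    · field_simp; ring
  · have hne : ∀ᶠ w : Phase in 𝓝 z, (w 0 * w 2) ^ 2 + κ ≠ 0 := by
      have : ContinuousAt (fun w : Phase => (w 0 * w 2) ^ 2 + κ) z := by fun_prop
      exact this.eventually_ne hD
    refine ⟨fun w => w 0 ^ 3 * w 2 * ((w 0 * w 2) ^ 2 + κ)⁻¹, ?_⟩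
    filter_upwards [hne, hx'] with w hw hxw
    have hs : ContDiffAt ℝ ∞ (fun w : Phase => (w 0 * w 2) ^ 2 + κ) w := by fun_prop
    have hs' : ContDiffAt ℝ ∞ (fun w : Phase => w 0 ^ 3 * w 2) w := by fun_prop
    have g := (((hasGrad_coord 0 w).pow 3).mul (hasGrad_coord 2 w)).mul
      (((((hasGrad_coord 0 w).mul (hasGrad_coord 2 w)).pow 2).add (hasGrad_const κ w)).inv hw)
    refine ⟨hs'.mul (hs.inv hw), hxw,
      (w 0 ^ 4 * w 2 ^ 3 + 3 * w 0 ^ 2 * w 2 * κ) / ((w 0 * w 2) ^ 2 + κ) ^ 2,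
      (w 0 ^ 3 * κ - w 0 ^ 5 * w 2 ^ 2) / ((w 0 * w 2) ^ 2 + κ) ^ 2,
      g.congr_grad fun i => ?_, ?_, ?_⟩
    · fin_cases i <;> simp <;> field_simp <;> ring
    · generalize hd : (w 0 * w 2) ^ 2 + κ = d at hw
      field_simp
      rw [← hd]; ring
    · generalize hd : (w 0 * w 2) ^ 2 + κ = d at hw
      field_simp
      rw [← hd]; ring

/-! ### The inverse square system in the frame of t, W, y, p_y. -/

/-- A quarter of the discriminant of the recursion operator for the potential `κ / x²`. -/
noncomputable def invSqDisc (κ : ℝ) (z : Phase) : ℝ :=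
  (z 2 ^ 2 + κ * (z 0 ^ 2)⁻¹) / 2 + z 3 ^ 2 / 4

theorem hasGrad_invSqDisc (κ : ℝ) {z : Phase} (hx : z 0 ≠ 0) :
    HasGrad (invSqDisc κ) ![-(κ / z 0 ^ 3), 0, z 2, z 3 / 2] z := by
  have g := ((((hasGrad_coord 2 z).pow 2).add
    ((((hasGrad_coord 0 z).pow 2).inv (pow_ne_zero 2 hx)).const_mul κ)).const_mul (1 / 2)).add
      (((hasGrad_coord 3 z).pow 2).const_mul (1 / 4))
  refine (g.congr_of_eventuallyEq (.of_forall fun w => ?_)).congr_grad fun i => ?_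
  · simp only [invSqDisc]; ring
  · fin_cases i <;> simp <;> field_simp; norm_num

theorem contDiffAt_invSqDisc (κ : ℝ) {z : Phase} (hx : z 0 ≠ 0) :
    ContDiffAt ℝ ∞ (invSqDisc κ) z := by
  have h : ContDiffAt ℝ ∞ (fun w : Phase => (w 0 ^ 2)⁻¹) z :=
    ContDiffAt.inv (by fun_prop) (pow_ne_zero 2 hx)
  unfold invSqDisc
  fun_prop

/-- The second Poisson tensor of the potential `κ / x²`. -/
noncomputable def invSqTensor (κ : ℝ) (z : Phase) : Matrix (Fin 4) (Fin 4) ℝ :=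
  blockTensor (z 0 / 2) 0 (z 2) (z 2 / 2) (z 3) (κ / z 0 ^ 3)

/-- Sandwiching by a product of matrices. -/
theorem sandwich_mul {K B P C : Matrix (Fin 4) (Fin 4) ℝ} (h : B * P * B.transpose = C) :
    (K * B) * P * (K * B).transpose = K * C * K.transpose := by
  rw [← h, Matrix.transpose_mul]; simp only [Matrix.mul_assoc]

/-- Coefficients of the differentials of the Toda coordinates with respect to the differentials of
the time, the discriminant, the cyclic coordinate and its momentum. -/
noncomputable def todaCoeff (p t G W : ℝ) : Matrix (Fin 4) (Fin 4) ℝ :=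
  !![-p / 2 + G, (t * G - 1) / (2 * W), 1, -t / 2;
    -p / 2 - G, -((t * G - 1) / (2 * W)), 1, -t / 2;
    W - G ^ 2, (G + t * (W - G ^ 2)) / (2 * W), 0, 1 / 2;
    -(W - G ^ 2), -((G + t * (W - G ^ 2)) / (2 * W)), 0, 1 / 2]

/-- The middle matrix holds the canonical brackets of t, W, y, p_y, as computed in
`timeFrame_canonical`. -/
theorem todaCoeff_canonical (p t G : ℝ) {W : ℝ} (hW : W ≠ 0) :
    todaCoeff p t G W * !![0, 1, 0, 0; -1, 0, -p / 2, 0; 0, p / 2, 0, 1; 0, 0, -1, 0]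
      * (todaCoeff p t G W).transpose = canP := by
  ext i j
  fin_cases i <;> fin_cases j <;>
    simp [canP, todaCoeff, Matrix.mul_apply, Fin.sum_univ_four] <;> field_simp <;> ring

/-- The middle matrix holds the second brackets of t, W, y, p_y. The result has the form of the Toda
tensor with a = 1 once W - G² is identified with its exponential entry. -/
theorem todaCoeff_tensor (p t G : ℝ) {W : ℝ} (hW : W ≠ 0) :
    todaCoeff p t G W * !![0, p / 2, t, 1; -p / 2, 0, -(W + p ^ 2 / 4), 0;
        -t, W + p ^ 2 / 4, 0, p; -1, 0, -p, 0] * (todaCoeff p t G W).transpose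
      = blockTensor 1 (p / 2 + G) 0 0 (p / 2 - G) (W - G ^ 2) := by
  ext i j
  fin_cases i <;> fin_cases j <;>
    simp [blockTensor, todaCoeff, Matrix.mul_apply, Fin.sum_univ_four] <;> field_simp <;> ring

/-- The differentials of the time, the discriminant, the cyclic coordinate and its momentum. -/
noncomputable def timeFrame (tx tp e px py : ℝ) : Matrix (Fin 4) (Fin 4) ℝ :=
  !![tx, 0, tp, 0; -e, 0, px, py / 2; 0, 1, 0, 0; 0, 0, 0, 1]

/-- Here e is the force κ/x³, and the hypothesis says that t is conjugate to W. -/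
theorem timeFrame_canonical {tx tp e px py : ℝ} (h : px * tx + e * tp = 1) :
    timeFrame tx tp e px py * canP * (timeFrame tx tp e px py).transpose
      = !![0, 1, 0, 0; -1, 0, -py / 2, 0; 0, py / 2, 0, 1; 0, 0, -1, 0] := by
  ext i j
  fin_cases i <;> fin_cases j <;>
    simp [canP, timeFrame, Matrix.mul_apply, Fin.sum_univ_four] <;> linarith

/-- The scaling weight of t enters only through the second bracket of t and y, which it makes equal
to t. -/
theorem timeFrame_tensor {tx tp e x px py t : ℝ} (h1 : px * tx + e * tp = 1)
    (h2 : x * tx - px * tp = 2 * t) :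
    timeFrame tx tp e px py * blockTensor (x / 2) 0 px (px / 2) py e
        * (timeFrame tx tp e px py).transpose
      = !![0, py / 2, t, 1; -py / 2, 0, -((px ^ 2 + e * x) / 2 + py ^ 2 / 4 + py ^ 2 / 4), 0;
          -t, (px ^ 2 + e * x) / 2 + py ^ 2 / 4 + py ^ 2 / 4, 0, py; -1, 0, -py, 0] := by
  ext i j
  fin_cases i <;> fin_cases j <;>
    simp [timeFrame, blockTensor, Matrix.mul_apply, Fin.sum_univ_four]
  · linear_combination (py / 2) * h1
  · linear_combination h2 / 2
  · linear_combination h1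
  · linear_combination -(py / 2) * h1
  · ring
  · ring
  · ring
  · linear_combination -h2 / 2
  · ring
  · linear_combination -h1
  · ring

/-- Near each point where the discriminant has the sign `s`, the potential `κ / x²` is mapped to
the Toda lattice. -/
theorem exists_toda_map {κ s : ℝ} (hκ : κ ≠ 0) {z : Phase} (hx : z 0 ≠ 0)
    (hs : s = 1 ∧ 0 < invSqDisc κ z ∨ s = -1 ∧ invSqDisc κ z < 0) :
    ∃ (φ : Phase → Phase) (J : Phase → Matrix (Fin 4) (Fin 4) ℝ), ∀ᶠ w in 𝓝 z,
      ContDiffAt ℝ ∞ φ w ∧ (∀ i, HasGrad (fun u => φ u i) (J w i) w) ∧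
      J w * canP * (J w).transpose = canP ∧
      J w * invSqTensor κ w * (J w).transpose = todaTensor 1 s (φ w) ∧
      natHam (todaV 1 s) (φ w) = w 2 ^ 2 + w 3 ^ 2 + κ / w 0 ^ 2 ∧
      φ w 2 + φ w 3 = w 3 := by
  obtain ⟨t, ht⟩ := exists_time hκ hx
  have hW : ∀ᶠ w in 𝓝 z, ContDiffAt ℝ ∞ (invSqDisc κ) w :=
    ((continuous_apply 0).continuousAt.eventually_ne hx).mono
      fun w hw => contDiffAt_invSqDisc κ hw
  have hLG : ∃ L G : Phase → ℝ, ∀ᶠ w in 𝓝 z,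
      ContDiffAt ℝ ∞ L w ∧ ContDiffAt ℝ ∞ G w ∧ invSqDisc κ w ≠ 0 ∧
      HasGrad L (fun i => (t w * G w - 1) / (2 * invSqDisc κ w) * grad (invSqDisc κ) w i
        + G w * grad t w i) w ∧
      HasGrad G (fun i => (G w + t w * (invSqDisc κ w - G w ^ 2)) / (2 * invSqDisc κ w)
        * grad (invSqDisc κ) w i + (invSqDisc κ w - G w ^ 2) * grad t w i) w ∧
      s * Real.exp (-(2 * L w)) = invSqDisc κ w - G w ^ 2 := by
    rcases hs with ⟨rfl, h⟩ | ⟨rfl, h⟩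
    · simpa only [one_mul] using exists_riccati_pos hW (ht.mono fun w h => h.1) h
    · simpa only [neg_mul, one_mul] using exists_riccati_neg hW (ht.mono fun w h => h.1) h
  obtain ⟨L, G, hLG⟩ := hLG
  -- Relative position 2L and relative momentum 2G come from the Riccati functions, and the total
  -- momentum is p_y. The centre y - p_y t/2 is shifted because {y, W} = p_y/2 and {t, W} = 1: the
  -- shift makes it commute with W as well as with t, hence with L and G up to their dependence on
  -- these two alone.
  refine ⟨fun w => ![w 1 - w 3 * t w / 2 + L w, w 1 - w 3 * t w / 2 - L w,
    w 3 / 2 + G w, w 3 / 2 - G w], fun w =>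
    todaCoeff (w 3) (t w) (G w) (invSqDisc κ w)
    * timeFrame (grad t w 0) (grad t w 2) (κ / w 0 ^ 3) (w 2) (w 3),
    ?_⟩
  filter_upwards [ht, hLG] with w ⟨htc, hxw, tx, tp, gt, h1, h2⟩ ⟨hLc, hGc, hW0, gL, gG, hexp⟩
  have gW := hasGrad_invSqDisc κ hxw
  rw [gt.grad, gW.grad] at gL gG
  simp only [gt.grad]
  have hWdef : invSqDisc κ w = (w 2 ^ 2 + κ * (w 0 ^ 2)⁻¹) / 2 + w 3 ^ 2 / 4 := rfl
  have gS := (hasGrad_coord 1 w).sub (((hasGrad_coord 3 w).mul gt).const_mul (1 / 2))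
  have gp := (hasGrad_coord 3 w).const_mul (1 / 2)
  have hB1 := timeFrame_canonical (py := w 3) h1
  have hB2 := timeFrame_tensor (py := w 3) h1 h2
  have h3 : κ * (w 0 ^ 2)⁻¹ = κ / w 0 ^ 3 * w 0 := by field_simp
  rw [← h3, ← hWdef] at hB2
  have h4 : w 1 - w 3 * t w / 2 - L w - (w 1 - w 3 * t w / 2 + L w) = -(2 * L w) := by ring
  refine ⟨?_, fun i => ?_, ?_, ?_, ?_, ?_⟩
  · rw [contDiffAt_pi]
    intro i
    fin_cases i <;> simp <;> fun_prop
  · fin_cases i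
    · refine ((gS.add gL).congr_of_eventuallyEq (.of_forall fun u => ?_)).congr_grad fun i => ?_
      · simp; ring
      · fin_cases i <;> simp [todaCoeff, timeFrame, Matrix.mul_apply, Fin.sum_univ_four] <;> ring
    · refine ((gS.sub gL).congr_of_eventuallyEq (.of_forall fun u => ?_)).congr_grad fun i => ?_
      · simp; ring
      · fin_cases i <;> simp [todaCoeff, timeFrame, Matrix.mul_apply, Fin.sum_univ_four] <;> ring
    · refine ((gp.add gG).congr_of_eventuallyEq (.of_forall fun u => ?_)).congr_grad fun i => ?_
      · simp; ring
      · fin_cases i <;> simp [todaCoeff, timeFrame, Matrix.mul_apply, Fin.sum_univ_four] <;> ring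
    · refine ((gp.sub gG).congr_of_eventuallyEq (.of_forall fun u => ?_)).congr_grad fun i => ?_
      · simp; ring
      · fin_cases i <;> simp [todaCoeff, timeFrame, Matrix.mul_apply, Fin.sum_univ_four] <;> ring
  · simp only [Matrix.cons_val]
    rw [sandwich_mul hB1, todaCoeff_canonical _ _ _ hW0]
  · simp only [Matrix.cons_val]
    rw [invSqTensor, sandwich_mul hB2, todaCoeff_tensor _ _ _ hW0, todaTensor_eq_blockTensor]
    simp only [Matrix.cons_val, Matrix.cons_val_zero, Matrix.cons_val_one, h4, div_one, hexp]
  · simp only [natHam, todaV, qpart, Matrix.cons_val, Matrix.cons_val_zero, Matrix.cons_val_one,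
      h4, div_one, mul_one]
    rw [mul_assoc, hexp, hWdef]
    ring
  · simp

/-! ### Consequences of the defining relations for the ansatz -/

/-- Only the composite is known to be differentiable, not F itself, so the derivative is taken along
a line in a momentum direction, on which the composite is constant. -/
theorem pd_comp_qpart {F : ℝ × ℝ → ℝ} {z : Phase} {m : Fin 4} (hm : m = 2 ∨ m = 3)
    (h : DifferentiableAt ℝ (fun w => F (qpart w)) z) : pd m (fun w => F (qpart w)) z = 0 := by
  rw [pd, ← h.lineDeriv_eq_fderiv, lineDeriv]
  have : (fun t : ℝ => F (qpart (z + t • Pi.single m 1))) = fun _ => F (qpart z) := by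
    funext t
    rcases hm with rfl | rfl <;> simp [qpart]
  rw [this, deriv_const]

/-- The gradient of a smooth function of the coordinates. -/
theorem hasGrad_comp_qpart {M : Set Phase} (hM : IsOpen M) {F : ℝ × ℝ → ℝ}
    (hF : ContDiffOn ℝ ∞ (fun w => F (qpart w)) M) {z : Phase} (hz : z ∈ M) :
    HasGrad (fun w => F (qpart w))
      ![pd 0 (fun w => F (qpart w)) z, pd 1 (fun w => F (qpart w)) z, 0, 0] z := by
  have h := hasGrad_of_contDiffOn hM hF hz
  refine h.congr_grad fun i => ?_
  fin_cases i
  · rfl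
  · rfl
  · exact pd_comp_qpart (.inl rfl) h.differentiableAt
  · exact pd_comp_qpart (.inr rfl) h.differentiableAt

/-- The gradients of the first derivatives of a smooth function of the coordinates. -/
theorem hasGrad_pd_comp_qpart {M : Set Phase} (hM : IsOpen M) {F : ℝ × ℝ → ℝ}
    (hF : ContDiffOn ℝ ∞ (fun w => F (qpart w)) M) (i : Fin 4) {z : Phase} (hz : z ∈ M) :
    HasGrad (pd i (fun w => F (qpart w)))
      ![pd 0 (pd i (fun w => F (qpart w))) z, pd 1 (pd i (fun w => F (qpart w))) z, 0, 0] z := by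
  have h := hasGrad_of_contDiffOn hM (contDiffOn_pd hM hF i) hz
  have h0 : ∀ m : Fin 4, m = 2 ∨ m = 3 → pd m (pd i (fun w => F (qpart w))) z = 0 := by
    intro m hm
    rw [pd_comm hM hF m i hz]
    have : HasGrad (pd m (fun w => F (qpart w))) 0 z :=
      (hasGrad_const 0 z).congr_of_eventuallyEq (by
        filter_upwards [hM.mem_nhds hz] with w hw
        exact pd_comp_qpart hm (hasGrad_of_contDiffOn hM hF hw).differentiableAt)
    rw [this.pd]; rfl
  refine h.congr_grad fun i => ?_
  fin_cases i
  · rfl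
  · rfl
  · exact h0 2 (.inl rfl)
  · exact h0 3 (.inr rfl)

theorem hasGrad_linear_momenta (r s : ℝ) (z : Phase) :
    HasGrad (fun w => r * w 2 + s * w 3) ![0, 0, r, s] z := by
  refine (((hasGrad_coord 2 z).const_mul r).add ((hasGrad_coord 3 z).const_mul s)).congr_grad
    fun i => ?_
  fin_cases i <;> simp

/-- The algebraic part of the Jacobi identity for the linear terms of the ansatz. -/
structure IsJacobiCoeff (c : Fin 8 → ℝ) : Prop where
  eq₁₁ : c 2 * c 5 - c 6 * c 1 - c 0 * (c 4 - c 1) - c 4 * (c 6 - c 3) = 0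
  eq₁₂ : c 1 * c 4 + c 3 * c 5 - c 5 * c 0 - c 7 * c 1 - c 1 * (c 4 - c 1) - c 5 * (c 6 - c 3) = 0
  eq₂₁ : c 0 * c 6 + c 2 * c 7 - c 4 * c 2 - c 6 * c 3 - c 2 * (c 4 - c 1) - c 6 * (c 6 - c 3) = 0
  eq₂₂ : c 1 * c 6 - c 5 * c 2 - c 3 * (c 4 - c 1) - c 7 * (c 6 - c 3) = 0

/-- Subtracting the Jacobi identity of P' from that of P + P' leaves the terms linear in the
constant tensor P, and these determine dh. Inserting dh back, the identities for the index triples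
(0,1,2) and (0,1,3) are linear forms in the momenta with constant coefficients, which must vanish.
-/
theorem linTensor_jacobi {M : Set Phase} (hM : IsOpen M) (hne : M.Nonempty) {c : Fin 8 → ℝ}
    {h f : ℝ × ℝ → ℝ} (h₁ : IsPoissonOn M (linTensor c h f))
    (h₂ : IsPoissonOn M (fun z => canP + (1 : ℝ) • linTensor c h f z)) :
    (∀ z ∈ M, HasGrad (fun w => h (qpart w)) ![c 4 - c 1, c 6 - c 3, 0, 0] z) ∧
      IsJacobiCoeff c := by
  have hh : ContDiffOn ℝ ∞ (fun w => h (qpart w)) M := h₁.smooth 0 1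
  have hf : ContDiffOn ℝ ∞ (fun w => f (qpart w)) M := h₁.smooth 2 3
  have g1 : ∀ z ∈ M, ∀ i j, HasGrad (fun w => linTensor c h f w i j) _ z := fun z hz =>
    hasGrad_blockTensor (hasGrad_comp_qpart hM hh hz) (hasGrad_linear_momenta (c 0) (c 1) z)
      (hasGrad_linear_momenta (c 2) (c 3) z) (hasGrad_linear_momenta (c 4) (c 5) z)
      (hasGrad_linear_momenta (c 6) (c 7) z) (hasGrad_comp_qpart hM hf hz)
  have g2 : ∀ z ∈ M, ∀ i j,
      HasGrad (fun w => (canP + (1 : ℝ) • linTensor c h f w) i j) _ z := fun z hz i j =>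
    (((hasGrad_const (canP i j) z).add ((g1 z hz i j).const_mul 1))).congr_grad
      fun m => by rw [Pi.zero_apply, zero_add, one_mul]
  have key : ∀ z ∈ M, pd 0 (fun w => h (qpart w)) z = c 4 - c 1 ∧
      pd 1 (fun w => h (qpart w)) z = c 6 - c 3 := by
    intro z hz
    have a1 := h₁.jacobi z hz 0 1 2
    have a2 := h₁.jacobi z hz 0 1 3
    have b1 := h₂.jacobi z hz 0 1 2
    have b2 := h₂.jacobi z hz 0 1 3
    simp only [(g1 z hz _ _).pd] at a1 a2
    simp only [(g2 z hz _ _).pd] at b1 b2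
    simp [Fin.sum_univ_four, linTensor_eq_blockTensor, blockTensor, canP] at a1 a2 b1 b2
    constructor
    · linear_combination a1 - b1
    · linear_combination a2 - b2
  refine ⟨fun z hz => ?_, ?_⟩
  · rw [← (key z hz).1, ← (key z hz).2]; exact hasGrad_comp_qpart hM hh hz
  · have k1 := eq_zero_of_linear_momenta hM hne
      (r := c 2 * c 5 - c 6 * c 1 - c 0 * (c 4 - c 1) - c 4 * (c 6 - c 3))
      (s := c 1 * c 4 + c 3 * c 5 - c 5 * c 0 - c 7 * c 1 - c 1 * (c 4 - c 1)
        - c 5 * (c 6 - c 3)) (fun z hz => by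
        have a1 := h₁.jacobi z hz 0 1 2
        simp only [(g1 z hz _ _).pd] at a1
        simp [Fin.sum_univ_four, linTensor_eq_blockTensor, blockTensor, key z hz] at a1
        linear_combination a1)
    have k2 := eq_zero_of_linear_momenta hM hne
      (r := c 0 * c 6 + c 2 * c 7 - c 4 * c 2 - c 6 * c 3 - c 2 * (c 4 - c 1)
        - c 6 * (c 6 - c 3))
      (s := c 1 * c 6 - c 5 * c 2 - c 3 * (c 4 - c 1) - c 7 * (c 6 - c 3)) (fun z hz => by
        have a1 := h₁.jacobi z hz 0 1 3
        simp only [(g1 z hz _ _).pd] at a1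
        simp [Fin.sum_univ_four, linTensor_eq_blockTensor, blockTensor, key z hz] at a1
        linear_combination a1)
    exact ⟨k1.1, k1.2, k2.1, k2.2⟩

theorem hasGrad_natHam {M : Set Phase} (hM : IsOpen M) {V : ℝ × ℝ → ℝ}
    (hV : ContDiffOn ℝ ∞ (fun w => V (qpart w)) M) {z : Phase} (hz : z ∈ M) :
    HasGrad (natHam V) ![pd 0 (fun w => V (qpart w)) z, pd 1 (fun w => V (qpart w)) z,
      2 * z 2, 2 * z 3] z := by
  have g := (((hasGrad_coord 2 z).pow 2).add ((hasGrad_coord 3 z).pow 2)).add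
    (hasGrad_comp_qpart hM hV hz)
  refine HasGrad.congr_grad (F := natHam V) g fun i => ?_
  fin_cases i <;> simp

theorem LenardMagriOn.grad_eq {M : Set Phase} {P' : Phase → Matrix (Fin 4) (Fin 4) ℝ}
    {H₁ H₂ : Phase → ℝ} (h : LenardMagriOn M P' H₁ H₂) {z : Phase} (hz : z ∈ M) :
    grad H₂ z = (recOp P' z).transpose.mulVec (grad H₁ z) := by
  obtain ⟨s₁, s₂, -, h2⟩ := h z hz
  simpa [controlMatrix] using (h2 0).symm

/-- The differential of the second integral. -/
theorem grad_second_integral {M : Set Phase} (hM : IsOpen M) {c : Fin 8 → ℝ}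
    {h f V : ℝ × ℝ → ℝ} {H₂ : Phase → ℝ} (hV : ContDiffOn ℝ ∞ (fun w => V (qpart w)) M)
    (hLM : LenardMagriOn M (linTensor c h f) (natHam V) H₂) {z : Phase} (hz : z ∈ M) :
    grad H₂ z =
      ![(c 0 * z 2 + c 1 * z 3) * pd 0 (fun w => V (qpart w)) z
          + (c 4 * z 2 + c 5 * z 3) * pd 1 (fun w => V (qpart w)) z - f (qpart z) * (2 * z 3),
        (c 2 * z 2 + c 3 * z 3) * pd 0 (fun w => V (qpart w)) z
          + (c 6 * z 2 + c 7 * z 3) * pd 1 (fun w => V (qpart w)) z + f (qpart z) * (2 * z 2),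
        h (qpart z) * pd 1 (fun w => V (qpart w)) z + (c 0 * z 2 + c 1 * z 3) * (2 * z 2)
          + (c 2 * z 2 + c 3 * z 3) * (2 * z 3),
        -h (qpart z) * pd 0 (fun w => V (qpart w)) z + (c 4 * z 2 + c 5 * z 3) * (2 * z 2)
          + (c 6 * z 2 + c 7 * z 3) * (2 * z 3)] := by
  rw [hLM.grad_eq hz, (hasGrad_natHam hM hV hz).grad, recOp, linTensor_eq_blockTensor,
    transpose_mulVec_blockTensor]
  simp

/-- The compatibility conditions for the second integral. -/
theorem second_integral_compat {M : Set Phase} (hM : IsOpen M) (hne : M.Nonempty)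
    {c : Fin 8 → ℝ} {h f V : ℝ × ℝ → ℝ} {H₂ : Phase → ℝ}
    (hh : ∀ z ∈ M, HasGrad (fun w => h (qpart w)) ![c 4 - c 1, c 6 - c 3, 0, 0] z)
    (hf : ContDiffOn ℝ ∞ (fun w => f (qpart w)) M)
    (hV : ContDiffOn ℝ ∞ (fun w => V (qpart w)) M) (hH : ContDiffOn ℝ ∞ H₂ M)
    (hLM : LenardMagriOn M (linTensor c h f) (natHam V) H₂) :
    (c 1 + c 2 = 2 * c 4 ∧ 2 * c 3 = c 5 + c 6) ∧
    ∀ z ∈ M, ∀ v v₁ v₂ : ℝ, v = h (qpart z) →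
      v₁ = pd 0 (fun w => V (qpart w)) z → v₂ = pd 1 (fun w => V (qpart w)) z →
      c 0 * v₁ + c 4 * v₂
        = (c 4 - c 1) * v₂ + v * pd 0 (pd 1 (fun w => V (qpart w))) z ∧
      c 1 * v₁ + c 5 * v₂ - 2 * f (qpart z)
        = -((c 4 - c 1) * v₁ + v * pd 0 (pd 0 (fun w => V (qpart w))) z) ∧
      c 2 * v₁ + c 6 * v₂ + 2 * f (qpart z)
        = (c 6 - c 3) * v₂ + v * pd 1 (pd 1 (fun w => V (qpart w))) z ∧
      c 3 * v₁ + c 7 * v₂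
        = -((c 6 - c 3) * v₁ + v * pd 1 (pd 0 (fun w => V (qpart w))) z) := by
  have gA : ∀ z : Phase, ∀ i j : Fin 8, _ := fun z i j => hasGrad_linear_momenta (c i) (c j) z
  have p0 : ∀ z ∈ M, HasGrad (pd 0 H₂) _ z := fun z hz =>
    (((gA z 0 1).mul (hasGrad_pd_comp_qpart hM hV 0 hz)).add
      ((gA z 4 5).mul (hasGrad_pd_comp_qpart hM hV 1 hz))).sub
      ((hasGrad_comp_qpart hM hf hz).mul ((hasGrad_coord 3 z).const_mul 2))
      |>.congr_of_eventuallyEq (by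
        filter_upwards [hM.mem_nhds hz] with w hw
        exact congrFun (grad_second_integral hM hV hLM hw) 0)
  have p1 : ∀ z ∈ M, HasGrad (pd 1 H₂) _ z := fun z hz =>
    (((gA z 2 3).mul (hasGrad_pd_comp_qpart hM hV 0 hz)).add
      ((gA z 6 7).mul (hasGrad_pd_comp_qpart hM hV 1 hz))).add
      ((hasGrad_comp_qpart hM hf hz).mul ((hasGrad_coord 2 z).const_mul 2))
      |>.congr_of_eventuallyEq (by
        filter_upwards [hM.mem_nhds hz] with w hw
        exact congrFun (grad_second_integral hM hV hLM hw) 1)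
  have p2 : ∀ z ∈ M, HasGrad (pd 2 H₂) _ z := fun z hz =>
    (((hh z hz).mul (hasGrad_pd_comp_qpart hM hV 1 hz)).add
      ((gA z 0 1).mul ((hasGrad_coord 2 z).const_mul 2))).add
      ((gA z 2 3).mul ((hasGrad_coord 3 z).const_mul 2))
      |>.congr_of_eventuallyEq (by
        filter_upwards [hM.mem_nhds hz] with w hw
        exact congrFun (grad_second_integral hM hV hLM hw) 2)
  have p3 : ∀ z ∈ M, HasGrad (pd 3 H₂) _ z := fun z hz =>
    (((hh z hz).neg.mul (hasGrad_pd_comp_qpart hM hV 0 hz)).add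
      ((gA z 4 5).mul ((hasGrad_coord 2 z).const_mul 2))).add
      ((gA z 6 7).mul ((hasGrad_coord 3 z).const_mul 2))
      |>.congr_of_eventuallyEq (by
        filter_upwards [hM.mem_nhds hz] with w hw
        exact congrFun (grad_second_integral hM hV hLM hw) 3)
  refine ⟨?_, fun z hz v v₁ v₂ e e₁ e₂ => ?_⟩
  -- Symmetry of the second derivatives in the two momenta is again a linear form in the momenta
  -- that vanishes on an open set.
  · have := eq_zero_of_linear_momenta hM hne (r := c 1 + c 2 - 2 * c 4)
      (s := 2 * c 3 - c 5 - c 6) (fun z hz => by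
        have a := pd_comm hM hH 3 2 hz
        rw [(p2 z hz).pd, (p3 z hz).pd] at a
        simp at a
        linear_combination a / 2)
    exact ⟨by linarith [this.1], by linarith [this.2]⟩
  -- The four mixed derivatives in one coordinate and one momentum give the equations for V and f.
  · have a1 := pd_comm hM hH 2 0 hz
    have a2 := pd_comm hM hH 3 0 hz
    have a3 := pd_comm hM hH 2 1 hz
    have a4 := pd_comm hM hH 3 1 hz
    rw [(p2 z hz).pd, (p0 z hz).pd] at a1
    rw [(p3 z hz).pd, (p0 z hz).pd] at a2
    rw [(p2 z hz).pd, (p1 z hz).pd] at a3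
    rw [(p3 z hz).pd, (p1 z hz).pd] at a4
    simp [← e, ← e₁, ← e₂] at a1 a2 a3 a4
    exact ⟨by linear_combination a1, by linear_combination a2, by linear_combination a3,
      by linear_combination a4⟩

/-- The trace and the determinant of a regular recursion operator do not vanish identically. -/
theorem not_regularOn_of_trace_or_det_eq_zero {M : Set Phase} (hne : M.Nonempty)
    {P' : Phase → Matrix (Fin 4) (Fin 4) ℝ} {h A B C D f : Phase → ℝ}
    (hP : ∀ z ∈ M, P' z = blockTensor (h z) (A z) (B z) (C z) (D z) (f z))
    (hss : M ⊆ semisimpleLocus P')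
    (h0 : (∀ z ∈ M, A z + D z = 0) ∨ ∀ z ∈ M, B z * C z + h z * f z - A z * D z = 0) :
    ¬ RegularOn M P' := by
  intro hreg
  obtain ⟨z, hz⟩ := hne
  obtain ⟨W, hW, hzW, hWM, l₁, l₂, hl₁, hl₂, hl, hind⟩ := hreg z hz
  obtain ⟨w, hw, hli⟩ := closure_nonempty_iff.1 ⟨z, hind hzW⟩
  have hrel : ∀ u ∈ W, l₁ u ≠ l₂ u ∧ l₁ u + l₂ u = ((A u + D u : ℝ) : ℂ) ∧
      l₁ u * l₂ u = -((B u * C u + h u * f u - A u * D u : ℝ) : ℂ) := by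
    intro u hu
    have hne : l₁ u ≠ l₂ u := by
      intro he
      have h2 : (eigenvalues P' u).ncard = 2 := hss (hWM hu)
      rw [hl u hu, he] at h2
      simp at h2
    refine ⟨hne, (quadratic_roots_eq_pair hne).1 ?_⟩
    rw [← hl u hu, eigenvalues_blockTensor (hP u (hWM hu))]
  have hWn := hW.mem_nhds hw
  have d1 := ((hl₁.contDiffAt hWn).differentiableAt (by simp)).hasFDerivAt
  have d2 := ((hl₂.contDiffAt hWn).differentiableAt (by simp)).hasFDerivAt
  rw [LinearIndependent.pair_iff] at hli
  -- A constant trace gives dl₁ + dl₂ = 0, and a vanishing product gives l₂ dl₁ + l₁ dl₂ = 0. In the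
  -- second case independence would force l₁ = l₂ = 0, against distinctness.
  rcases h0 with h0 | h0
  · have e : HasFDerivAt (l₁ + l₂) (0 : Phase →L[ℝ] ℂ) w :=
      (hasFDerivAt_const (0 : ℂ) w).congr_of_eventuallyEq (by
        filter_upwards [hWn] with u hu
        rw [Pi.add_apply, (hrel u hu).2.1, h0 u (hWM hu), Complex.ofReal_zero])
    have := hli 1 1 (by rw [one_smul, one_smul]; exact (d1.add d2).unique e)
    exact one_ne_zero this.1
  · have e : HasFDerivAt (l₁ * l₂) (0 : Phase →L[ℝ] ℂ) w :=
      (hasFDerivAt_const (0 : ℂ) w).congr_of_eventuallyEq (by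
        filter_upwards [hWn] with u hu
        rw [Pi.mul_apply, (hrel u hu).2.2, h0 u (hWM hu), Complex.ofReal_zero, neg_zero])
    have := hli (l₂ w) (l₁ w) (by rw [add_comm]; exact (d1.mul d2).unique e)
    exact (hrel w hw).1 (this.2.trans this.1.symm)

/-! ### Classification of the solutions in an adapted orthonormal frame -/

/-- The trilinear form with coefficients `c`. -/
def tri (c : Fin 8 → ℝ) (u v w : ℝ × ℝ) : ℝ :=
  u.1 * (v.1 * (c 0 * w.1 + c 1 * w.2) + v.2 * (c 2 * w.1 + c 3 * w.2))
    + u.2 * (v.1 * (c 4 * w.1 + c 5 * w.2) + v.2 * (c 6 * w.1 + c 7 * w.2))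

/-- The coefficients of the ansatz in the frame `n, m`. -/
def frameCoeff (c : Fin 8 → ℝ) (n m : ℝ × ℝ) : Fin 8 → ℝ :=
  ![tri c n n n, tri c n n m, tri c n m n, tri c n m m,
    tri c m n n, tri c m n m, tri c m m n, tri c m m m]

/-- The relations transform as a tensor with two free indices under a rotation with scaling. Being
quadratic in c, they have degree six in the frame, and the four degrees not used by the free indices
form the factor (a² + b²)². -/
theorem IsJacobiCoeff.frameCoeff {c : Fin 8 → ℝ} (hc : IsJacobiCoeff c) (a b : ℝ) :
    IsJacobiCoeff (frameCoeff c (a, b) (-b, a)) := by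
  obtain ⟨h1, h2, h3, h4⟩ := hc
  constructor
  · simp [_root_.frameCoeff, tri]
    linear_combination (a ^ 2 + b ^ 2) ^ 2 * (a * (a * h1 + b * h2) + b * (a * h3 + b * h4))
  · simp [_root_.frameCoeff, tri]
    linear_combination (a ^ 2 + b ^ 2) ^ 2 * (a * (-b * h1 + a * h2) + b * (-b * h3 + a * h4))
  · simp [_root_.frameCoeff, tri]
    linear_combination (a ^ 2 + b ^ 2) ^ 2 * (-b * (a * h1 + b * h2) + a * (a * h3 + b * h4))
  · simp [_root_.frameCoeff, tri]
    linear_combination (a ^ 2 + b ^ 2) ^ 2 * (-b * (-b * h1 + a * h2) + a * (-b * h3 + a * h4))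

theorem closed_frameCoeff {c : Fin 8 → ℝ} (h : c 1 + c 2 = 2 * c 4 ∧ 2 * c 3 = c 5 + c 6)
    (a b : ℝ) : tri c (a, b) (a, b) (-b, a) + tri c (a, b) (-b, a) (a, b)
        = 2 * tri c (-b, a) (a, b) (a, b) ∧
      2 * tri c (a, b) (-b, a) (-b, a)
        = tri c (-b, a) (a, b) (-b, a) + tri c (-b, a) (-b, a) (a, b) := by
  obtain ⟨h1, h2⟩ := h
  constructor <;> simp only [tri]
  · linear_combination (a ^ 2 + b ^ 2) * (a * h1 + b * h2)
  · linear_combination (a ^ 2 + b ^ 2) * (-b * h1 + a * h2)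

theorem tri_expand (c : Fin 8 → ℝ) {a b : ℝ} (hN : a ^ 2 + b ^ 2 = 1) (u v w : ℝ × ℝ) :
    tri c u v w = tri c u v (a, b) * (a * w.1 + b * w.2)
      + tri c u v (-b, a) * (-b * w.1 + a * w.2) := by
  simp only [tri]
  linear_combination -(u.1 * (v.1 * (c 0 * w.1 + c 1 * w.2) + v.2 * (c 2 * w.1 + c 3 * w.2))
    + u.2 * (v.1 * (c 4 * w.1 + c 5 * w.2) + v.2 * (c 6 * w.1 + c 7 * w.2))) * hN

/-- The real solutions of the algebraic conditions. -/
theorem jacobiCoeff_cases {c : Fin 8 → ℝ} (hc : IsJacobiCoeff c)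
    (hcl : c 1 + c 2 = 2 * c 4 ∧ 2 * c 3 = c 5 + c 6) (h0 : c 0 = 0) (h6 : c 6 = 0)
    (htr : c 1 + c 7 ≠ 0) :
    c 3 = 0 ∧ c 5 = 0 ∧
      (c 1 = 0 ∧ c 2 = 0 ∧ c 4 = 0 ∨
        c 1 = 2 * c 4 ∧ c 2 = 0 ∧ c 7 = 2 * c 4 ∨
        c 4 ≠ 0 ∧ c 1 = 0 ∧ c 2 = 2 * c 4 ∧ c 7 = 2 * c 4 ∨
        c 4 ≠ 0 ∧ c 1 = c 4 ∧ c 2 = c 4 ∧ c 7 = c 4) := by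
  obtain ⟨e1, e2, e3, e4⟩ := hc
  obtain ⟨l1, l2⟩ := hcl
  rw [h0, h6] at e1 e2 e3
  rw [h6] at e4
  rw [h6] at l2
  have h5 : c 5 = 2 * c 3 := by linarith
  have h4 : c 4 = (c 1 + c 2) / 2 := by linarith
  rw [h5] at e1 e2 e4
  rw [h4] at e1 e2 e3 e4
  -- If c 3 were nonzero, dividing the first and last relations by it would determine c 7 and give c
  -- 1 + c 7 = 0, against `htr`.
  have h3 : c 3 = 0 := by
    by_contra h3
    have k1 : 5 * c 2 + c 1 = 0 := by
      apply mul_left_cancel₀ h3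
      linear_combination 2 * e1
    have k4 : c 7 = 2 * c 2 + (c 2 + c 1) / 2 - c 1 := by
      apply mul_left_cancel₀ h3
      linear_combination e4
    apply htr
    linear_combination k4 + k1 / 2
  rw [h3] at e2 h5
  refine ⟨h3, by linarith, ?_⟩
  -- The two surviving relations factor, and the choices of factors are the four cases.
  have f2 : c 1 * (c 1 - c 7) = 0 := by linear_combination e2
  have f3 : c 2 * (c 7 - c 2) = 0 := by linear_combination e3
  rcases mul_eq_zero.1 f2 with k | k <;> rcases mul_eq_zero.1 f3 with l | l
  · exact .inl ⟨k, l, by rw [h4, k, l]; norm_num⟩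
  · have h7 : c 7 = 2 * c 4 := by linarith
    refine .inr (.inr (.inl ⟨fun h => htr ?_, k, by linarith, h7⟩))
    rw [h7, k, h]; norm_num
  · exact .inr (.inl ⟨by linarith, l, by linarith⟩)
  · have h7 : c 7 = c 4 := by linarith
    refine .inr (.inr (.inr ⟨fun h => htr ?_, by linarith, by linarith, h7⟩))
    rw [h7, h]; linarith

/-! ### Integration of the differential equations for the potential. -/

theorem hasGrad_linear_coordinates (r s : ℝ) (z : Phase) :
    HasGrad (fun w => r * w 0 + s * w 1) ![r, s, 0, 0] z := by
  refine (((hasGrad_coord 0 z).const_mul r).add ((hasGrad_coord 1 z).const_mul s)).congr_grad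
    fun i => ?_
  fin_cases i <;> simp

/-- Solving the equation `h g' = -3 u g` with `h' = u`. -/
theorem exists_inverse_square {M : Set Phase} (hM : IsOpen M) (hc : IsPreconnected M)
    {a b u : ℝ} (hN : a ^ 2 + b ^ 2 = 1) (hu : u ≠ 0) {h g γ v : Phase → ℝ}
    (gh : ∀ z ∈ M, HasGrad h ![a * u, b * u, 0, 0] z)
    (gg : ∀ z ∈ M, HasGrad g ![a * γ z, b * γ z, 0, 0] z)
    (gv : ∀ z ∈ M, HasGrad v ![a * g z, b * g z, 0, 0] z)
    (hode : ∀ z ∈ M, 3 * u * g z = -(h z * γ z)) (hne : ∃ z ∈ M, g z ≠ 0) :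
    ∃ x₀ κ C : ℝ, κ ≠ 0 ∧ ∀ z ∈ M, a * z 0 + b * z 1 + x₀ ≠ 0 ∧
      h z = u * (a * z 0 + b * z 1 + x₀) ∧
      v z = C + κ / (a * z 0 + b * z 1 + x₀) ^ 2 ∧
      g z = -2 * κ / (a * z 0 + b * z 1 + x₀) ^ 3 := by
  -- The equation says exactly that h³g is constant.
  obtain ⟨K, hK⟩ := exists_const_of_hasGrad_zero hM hc (F := fun z => h z ^ 3 * g z)
    fun z hz => (((gh z hz).pow 3).mul (gg z hz)).congr_grad fun i => by
      have := hode z hz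
      fin_cases i <;> simp
      · linear_combination (-a * h z ^ 2) * (-this)
      · linear_combination (-b * h z ^ 2) * (-this)
  -- Otherwise h would vanish near a point with g ≠ 0, although dh ≠ 0. Consequently h has no zero
  -- on M, and division by x is legitimate.
  have hK0 : K ≠ 0 := by
    rintro rfl
    obtain ⟨z, hz, hgz⟩ := hne
    have hev : h =ᶠ[𝓝 z] fun _ => 0 := by
      filter_upwards [hM.mem_nhds hz,
        (gg z hz).differentiableAt.continuousAt.eventually_ne hgz] with w hw hgw
      exact pow_eq_zero_iff (three_ne_zero) |>.1 ((mul_eq_zero.1 (hK w hw)).resolve_right hgw)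
    have h3 := ((hasGrad_const 0 z).congr_of_eventuallyEq hev).unique (gh z hz)
    have ha : a = 0 := by simpa [hu] using (congrFun h3 0).symm
    have hb : b = 0 := by simpa [hu] using (congrFun h3 1).symm
    rw [ha, hb] at hN
    norm_num at hN
  have hh0 : ∀ z ∈ M, h z ≠ 0 := fun z hz h0 => hK0 (by rw [← hK z hz, h0]; ring)
  obtain ⟨y, hy⟩ := exists_const_of_hasGrad_zero hM hc
    (F := fun z => h z - u * (a * z 0 + b * z 1))
    fun z hz => ((gh z hz).sub ((hasGrad_linear_coordinates a b z).const_mul u)).congr_grad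
      fun i => by fin_cases i <;> simp <;> ring
  obtain ⟨C, hC⟩ := exists_const_of_hasGrad_zero hM hc
    (F := fun z => v z + K / (2 * u) * (h z ^ 2)⁻¹)
    fun z hz => ((gv z hz).add ((((gh z hz).pow 2).inv
      (pow_ne_zero 2 (hh0 z hz))).const_mul (K / (2 * u)))).congr_grad fun i => by
      have h0 := hh0 z hz
      have hKz := hK z hz
      fin_cases i <;> simp <;> field_simp
      · linear_combination a * hKz
      · linear_combination b * hKz
  have hx : ∀ z ∈ M, h z = u * (a * z 0 + b * z 1 + y / u) := fun z hz => by
    have := hy z hz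
    field_simp
    linear_combination this
  refine ⟨y / u, -K / (2 * u ^ 3), C, by
    exact div_ne_zero (neg_ne_zero.2 hK0) (by positivity), fun z hz => ?_⟩
  have h0 := hh0 z hz
  have hKz := hK z hz
  have hCz := hC z hz
  have hxz := hx z hz
  rw [hxz] at h0 hKz hCz
  generalize a * z 0 + b * z 1 + y / u = x at *
  have hx0 : x ≠ 0 := fun h => h0 (by rw [h, mul_zero])
  refine ⟨hx0, hxz, ?_, ?_⟩
  · rw [← hCz]; field_simp; ring
  · rw [← hKz]; field_simp

/-- Solving the equation `h g' = -2 u g` with constant `h`. -/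
theorem exists_exponential {M : Set Phase} (hM : IsOpen M) (hc : IsPreconnected M)
    {a b u : ℝ} (hu : u ≠ 0) {h g γ v : Phase → ℝ}
    (gh : ∀ z ∈ M, HasGrad h 0 z)
    (gg : ∀ z ∈ M, HasGrad g ![a * γ z, b * γ z, 0, 0] z)
    (gv : ∀ z ∈ M, HasGrad v ![a * g z, b * g z, 0, 0] z)
    (hode : ∀ z ∈ M, 2 * u * g z = -(h z * γ z)) (hne : ∃ z ∈ M, g z ≠ 0) :
    ∃ h₀ K C : ℝ, h₀ ≠ 0 ∧ K ≠ 0 ∧ ∀ z ∈ M, h z = h₀ ∧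
      v z = C + K * Real.exp (-(2 * u / h₀) * (a * z 0 + b * z 1)) ∧
      g z = -(2 * u / h₀) * (K * Real.exp (-(2 * u / h₀) * (a * z 0 + b * z 1))) := by
  obtain ⟨h₀, hh₀⟩ := exists_const_of_hasGrad_zero hM hc gh
  have hh0 : h₀ ≠ 0 := by
    rintro rfl
    obtain ⟨z, hz, hgz⟩ := hne
    have := hode z hz
    rw [hh₀ z hz, zero_mul, neg_zero] at this
    exact (mul_ne_zero (mul_ne_zero two_ne_zero hu) hgz) this
  have hγ : ∀ z ∈ M, γ z = -(2 * u / h₀) * g z := fun z hz => by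
    have := hode z hz
    rw [hh₀ z hz] at this
    field_simp
    linear_combination this
  obtain ⟨C, hC⟩ := exists_const_of_hasGrad_zero hM hc
    (F := fun z => v z + h₀ / (2 * u) * g z)
    fun z hz => ((gv z hz).add ((gg z hz).const_mul (h₀ / (2 * u)))).congr_grad fun i => by
      fin_cases i <;> simp [hγ z hz] <;> field_simp <;> ring
  obtain ⟨L, hL⟩ := exists_const_of_hasGrad_zero hM hc
    (F := fun z => g z * Real.exp (2 * u / h₀ * (a * z 0 + b * z 1)))
    fun z hz => ((gg z hz).mul
      ((hasGrad_linear_coordinates a b z).const_mul (2 * u / h₀)).exp).congr_grad fun i => by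
      fin_cases i <;> simp [hγ z hz] <;> ring
  have hg : ∀ z ∈ M, g z = L * Real.exp (-(2 * u / h₀) * (a * z 0 + b * z 1)) := fun z hz => by
    rw [← hL z hz, mul_assoc, ← Real.exp_add]
    ring_nf
    simp
  refine ⟨h₀, -(h₀ / (2 * u)) * L, C, hh0, ?_, fun z hz => ⟨hh₀ z hz, ?_, ?_⟩⟩
  · obtain ⟨z, hz, hgz⟩ := hne
    refine mul_ne_zero (neg_ne_zero.2 (div_ne_zero hh0 (by simpa using hu))) ?_
    rintro rfl
    exact hgz (by rw [hg z hz, zero_mul])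
  · rw [← hC z hz, hg z hz]; ring
  · rw [hg z hz]; field_simp

/-! ### Rotation of the phase space to the adapted frame. -/

/-- The simultaneous rotation of coordinates and momenta to the frame `(a, b)`, `(-b, a)`. -/
def frameRot (a b : ℝ) : Matrix (Fin 4) (Fin 4) ℝ :=
  !![a, b, 0, 0; -b, a, 0, 0; 0, 0, a, b; 0, 0, -b, a]

theorem frameRot_linTensor (c : Fin 8 → ℝ) (h f : ℝ × ℝ → ℝ) {a b : ℝ} (hN : a ^ 2 + b ^ 2 = 1)
    (z : Phase) :
    frameRot a b * linTensor c h f z * (frameRot a b).transpose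
      = blockTensor (h (qpart z)) (tri c (a, b) (a, b) (z 2, z 3))
        (tri c (a, b) (-b, a) (z 2, z 3)) (tri c (-b, a) (a, b) (z 2, z 3))
        (tri c (-b, a) (-b, a) (z 2, z 3)) (f (qpart z)) := by
  rw [linTensor_eq_blockTensor]
  ext i j
  fin_cases i <;> fin_cases j <;>
    simp [frameRot, blockTensor, Matrix.mul_apply, Fin.sum_univ_four, tri]
  · ring
  · linear_combination h (qpart z) * hN
  · ring
  · ring
  · linear_combination -h (qpart z) * hN
  · ring
  · ring
  · ring
  · ring
  · ring
  · ring
  · linear_combination f (qpart z) * hN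
  · ring
  · ring
  · linear_combination -f (qpart z) * hN
  · ring

theorem mem_semisimpleLocus_linTensor (c : Fin 8 → ℝ) (h f : ℝ × ℝ → ℝ) {a b : ℝ}
    (hN : a ^ 2 + b ^ 2 = 1) (z : Phase) :
    z ∈ semisimpleLocus (linTensor c h f) ↔
      (tri c (a, b) (a, b) (z 2, z 3) + tri c (-b, a) (-b, a) (z 2, z 3)) ^ 2
        + 4 * (tri c (a, b) (-b, a) (z 2, z 3) * tri c (-b, a) (a, b) (z 2, z 3)
          + h (qpart z) * f (qpart z)
          - tri c (a, b) (a, b) (z 2, z 3) * tri c (-b, a) (-b, a) (z 2, z 3)) ≠ 0 := by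
  rw [mem_semisimpleLocus_blockTensor (linTensor_eq_blockTensor c h f z)]
  have e1 : tri c (a, b) (a, b) (z 2, z 3) + tri c (-b, a) (-b, a) (z 2, z 3)
      = (a ^ 2 + b ^ 2) * (c 0 * z 2 + c 1 * z 3 + (c 6 * z 2 + c 7 * z 3)) := by
    simp only [tri]; ring
  have e2 : tri c (a, b) (-b, a) (z 2, z 3) * tri c (-b, a) (a, b) (z 2, z 3)
      + h (qpart z) * f (qpart z)
      - tri c (a, b) (a, b) (z 2, z 3) * tri c (-b, a) (-b, a) (z 2, z 3)
      = (a ^ 2 + b ^ 2) ^ 2 * ((c 2 * z 2 + c 3 * z 3) * (c 4 * z 2 + c 5 * z 3)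
        - (c 0 * z 2 + c 1 * z 3) * (c 6 * z 2 + c 7 * z 3))
      + h (qpart z) * f (qpart z) := by
    simp only [tri]; ring
  rw [e1, e2, hN]
  ring_nf

theorem exists_unit_frame {s₁ s₂ : ℝ} (h : ¬(s₁ = 0 ∧ s₂ = 0)) :
    ∃ a b r : ℝ, a ^ 2 + b ^ 2 = 1 ∧ r ≠ 0 ∧ s₁ = -b * r ∧ s₂ = a * r := by
  have hpos : 0 < s₁ ^ 2 + s₂ ^ 2 := by
    rcases not_and_or.1 h with h | h <;> positivity
  have hr := Real.sq_sqrt hpos.le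
  have hr0 := (Real.sqrt_pos.2 hpos).ne'
  generalize √(s₁ ^ 2 + s₂ ^ 2) = r at hr hr0
  refine ⟨s₂ / r, -s₁ / r, r, ?_, hr0, ?_, ?_⟩ <;> field_simp
  linarith

/-- In a suitable orthonormal frame, a nontrivial solution in the ansatz has an inverse square
potential or an exponential potential. -/
theorem IsNontrivialSolution.classification {M : Set Phase} {c : Fin 8 → ℝ} {h f V : ℝ × ℝ → ℝ}
    {H₂ : Phase → ℝ} (hM : IsOpen M) (hconn : IsConnected M)
    (hsol : IsNontrivialSolution M (linTensor c h f) V H₂) :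
    ∃ a b : ℝ, a ^ 2 + b ^ 2 = 1 ∧
      ((∃ u x₀ κ C : ℝ, u ≠ 0 ∧ κ ≠ 0 ∧ ∀ z ∈ M,
        a * z 0 + b * z 1 + x₀ ≠ 0 ∧
        frameRot a b * linTensor c h f z * (frameRot a b).transpose
          = (2 * u) • blockTensor ((a * z 0 + b * z 1 + x₀) / 2) 0 (a * z 2 + b * z 3)
            ((a * z 2 + b * z 3) / 2) (-b * z 2 + a * z 3)
            (κ / (a * z 0 + b * z 1 + x₀) ^ 3) ∧
        V (qpart z) = C + κ / (a * z 0 + b * z 1 + x₀) ^ 2 ∧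
        ((a * z 2 + b * z 3) ^ 2 + κ / (a * z 0 + b * z 1 + x₀) ^ 2) / 2
          + (-b * z 2 + a * z 3) ^ 2 / 4 ≠ 0) ∨
      (∃ u h₀ K C : ℝ, u ≠ 0 ∧ h₀ ≠ 0 ∧ K ≠ 0 ∧ ∀ z ∈ M,
        frameRot a b * linTensor c h f z * (frameRot a b).transpose
          = u • blockTensor (h₀ / u) (-b * z 2 + a * z 3) (a * z 2 + b * z 3)
            (a * z 2 + b * z 3) (-b * z 2 + a * z 3)
            (u / h₀ * (K * Real.exp (-(2 * u / h₀) * (a * z 0 + b * z 1)))) ∧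
        V (qpart z) = C + K * Real.exp (-(2 * u / h₀) * (a * z 0 + b * z 1)))) := by
  have hne := hconn.nonempty
  have hV : ContDiffOn ℝ ∞ (fun w => V (qpart w)) M :=
    hsol.smooth_V.comp (by unfold qpart; fun_prop) (Set.mapsTo_image _ _)
  have hf : ContDiffOn ℝ ∞ (fun w => f (qpart w)) M := hsol.poisson.smooth 2 3
  obtain ⟨hh, hjac⟩ := linTensor_jacobi hM hne hsol.poisson (hsol.pencil 1)
  obtain ⟨hcl, hX⟩ := second_integral_compat hM hne hh hf hV hsol.smooth_H₂ hsol.chain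
  have hreg0 := fun h0 => not_regularOn_of_trace_or_det_eq_zero hne
    (fun z _ => linTensor_eq_blockTensor c h f z) hsol.semisimple h0 hsol.regular
  have hs : ¬(c 0 + c 6 = 0 ∧ c 1 + c 7 = 0) := fun hs => hreg0 (.inl fun z _ => by
    linear_combination z 2 * hs.1 + z 3 * hs.2)
  -- The trace of N is r times the momentum along (-b, a).
  obtain ⟨a, b, r, hN, hr, hs1, hs2⟩ := exists_unit_frame hs
  refine ⟨a, b, hN, ?_⟩
  set v : Phase → ℝ := fun w => V (qpart w) with hv
  set g : Phase → ℝ := fun w => a * pd 0 v w + b * pd 1 v w with hg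
  have gv0 : ∀ z ∈ M, HasGrad (pd 0 v) ![pd 0 (pd 0 v) z, pd 1 (pd 0 v) z, 0, 0] z :=
    fun z hz => hasGrad_pd_comp_qpart hM hV 0 hz
  have gv1 : ∀ z ∈ M, HasGrad (pd 1 v) ![pd 0 (pd 1 v) z, pd 1 (pd 1 v) z, 0, 0] z :=
    fun z hz => hasGrad_pd_comp_qpart hM hV 1 hz
  have hsym : ∀ z ∈ M, pd 1 (pd 0 v) z = pd 0 (pd 1 v) z := fun z hz => pd_comm hM hV 1 0 hz
  -- The sum of the first and last compatibility equations says that the trace form annihilates dV,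
  -- so dV is g times (a, b).
  have hm : ∀ z ∈ M, -b * pd 0 v z + a * pd 1 v z = 0 := fun z hz => by
    obtain ⟨x1, -, -, x4⟩ := hX z hz _ _ _ rfl rfl rfl
    rw [hsym z hz] at x4
    have : r * (-b * pd 0 v z + a * pd 1 v z) = 0 := by
      linear_combination x1 + x4 - pd 0 v z * hs1 - pd 1 v z * hs2
    exact (mul_eq_zero.1 this).resolve_left hr
  have hm' : ∀ z ∈ M, -b * pd 0 (pd 0 v) z + a * pd 0 (pd 1 v) z = 0 ∧
      -b * pd 0 (pd 1 v) z + a * pd 1 (pd 1 v) z = 0 := fun z hz => by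
    have h1 := ((gv0 z hz).const_mul (-b)).add ((gv1 z hz).const_mul a)
    have h2 : HasGrad (fun w => -b * pd 0 v w + a * pd 1 v w) 0 z :=
      (hasGrad_const 0 z).congr_of_eventuallyEq (by
        filter_upwards [hM.mem_nhds hz] with w hw using hm w hw)
    have h3 := h1.unique h2
    have h30 := congrFun h3 0
    have h31 := congrFun h3 1
    simp [hsym z hz] at h30 h31
    exact ⟨by linear_combination h30, by linear_combination h31⟩
  set γ : Phase → ℝ := fun w => a * (a * pd 0 (pd 0 v) w + b * pd 0 (pd 1 v) w)
    + b * (a * pd 0 (pd 1 v) w + b * pd 1 (pd 1 v) w) with hγ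
  have gg : ∀ z ∈ M, HasGrad g ![a * γ z, b * γ z, 0, 0] z := fun z hz => by
    refine (((gv0 z hz).const_mul a).add ((gv1 z hz).const_mul b)).congr_grad fun i => ?_
    obtain ⟨m1, m2⟩ := hm' z hz
    fin_cases i <;> simp [hγ, hsym z hz]
    · linear_combination -b * a * m1 - b ^ 2 * m2
        - (a * pd 0 (pd 0 v) z + b * pd 0 (pd 1 v) z) * hN
    · linear_combination a ^ 2 * m1 + a * b * m2
        - (a * pd 0 (pd 1 v) z + b * pd 1 (pd 1 v) z) * hN
  have gv : ∀ z ∈ M, HasGrad v ![a * g z, b * g z, 0, 0] z := fun z hz => by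
    refine (hasGrad_comp_qpart hM hV hz).congr_grad fun i => ?_
    have m1 := hm z hz
    fin_cases i <;> simp [hg]
    · linear_combination -b * m1 - pd 0 v z * hN
    · linear_combination a * m1 - pd 1 v z * hN
  have hgne : ∃ z ∈ M, g z ≠ 0 := by
    by_contra! hcon
    obtain ⟨C, hC⟩ := exists_const_of_hasGrad_zero hM hconn.isPreconnected (F := v)
      fun z hz => (gv z hz).congr_grad fun i => by
        fin_cases i <;> simp [hcon z hz]
    obtain ⟨z, hz, z', hz', hzz⟩ := hsol.nonconst
    exact hzz ((hC z hz).trans (hC z' hz').symm)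
  have hval : ∀ z ∈ M, pd 0 v z = a * g z ∧ pd 1 v z = b * g z ∧
      pd 0 (pd 0 v) z = a ^ 2 * γ z ∧ pd 0 (pd 1 v) z = a * b * γ z ∧
      pd 1 (pd 1 v) z = b ^ 2 * γ z := fun z hz => by
    have g0 := (gv0 z hz).unique (((gg z hz).const_mul a).congr_of_eventuallyEq (by
      filter_upwards [hM.mem_nhds hz] with w hw using (gv w hw).pd 0))
    have g1 := (gv1 z hz).unique (((gg z hz).const_mul b).congr_of_eventuallyEq (by
      filter_upwards [hM.mem_nhds hz] with w hw using (gv w hw).pd 1))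
    have g00 := congrFun g0 0
    have g01 := congrFun g1 0
    have g11 := congrFun g1 1
    simp at g00 g01 g11
    exact ⟨(gv z hz).pd 0, (gv z hz).pd 1, by rw [g00]; ring, by rw [g01]; ring,
      by rw [g11]; ring⟩
  -- These are the compatibility equations contracted with the frame; γ is the second derivative of
  -- V along (a, b).
  have hE : ∀ z ∈ M, tri c (a, b) (a, b) (a, b) * g z = 0 ∧
      tri c (-b, a) (a, b) (a, b) * g z - 2 * f (qpart z) = -(h (qpart z) * γ z) ∧
      tri c (a, b) (-b, a) (a, b) * g z + 2 * f (qpart z) = 0 ∧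
      tri c (-b, a) (-b, a) (a, b) * g z = 0 := fun z hz => by
    obtain ⟨x1, x2, x3, x4⟩ := hX z hz _ _ _ rfl rfl rfl
    rw [hsym z hz] at x4
    obtain ⟨v0, v1, v00, v01, v11⟩ := hval z hz
    rw [v0, v1, v01] at x1
    rw [v0, v1, v00] at x2
    rw [v0, v1, v11] at x3
    rw [v0, v1, v01] at x4
    simp only [tri]
    refine ⟨?_, ?_, ?_, ?_⟩
    · linear_combination a ^ 2 * x1 + a * b * x2 + a * b * x3 + b ^ 2 * x4
    · linear_combination -a * b * x1 + a ^ 2 * x2 - b ^ 2 * x3 + a * b * x4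
        + (2 * f (qpart z) - h (qpart z) * γ z * (a ^ 2 + b ^ 2 + 1)) * hN
    · linear_combination -a * b * x1 - b ^ 2 * x2 + a ^ 2 * x3 + a * b * x4
        - 2 * f (qpart z) * hN
    · linear_combination b ^ 2 * x1 - a * b * x2 - a * b * x3 + a ^ 2 * x4
  have h0 : tri c (a, b) (a, b) (a, b) = 0 := by
    obtain ⟨z, hz, hgz⟩ := hgne
    exact (mul_eq_zero.1 (hE z hz).1).resolve_right hgz
  have h6 : tri c (-b, a) (-b, a) (a, b) = 0 := by
    obtain ⟨z, hz, hgz⟩ := hgne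
    exact (mul_eq_zero.1 (hE z hz).2.2.2).resolve_right hgz
  have htr : tri c (a, b) (a, b) (-b, a) + tri c (-b, a) (-b, a) (-b, a) ≠ 0 := by
    intro h
    apply hr
    simp only [tri] at h
    linear_combination h - (a ^ 2 + b ^ 2) * (-b * hs1 + a * hs2)
      - r * (a ^ 2 + b ^ 2 + 1) * hN
  obtain ⟨h3, h5, hcases⟩ := jacobiCoeff_cases (hjac.frameCoeff a b)
    (closed_frameCoeff hcl a b) h0 h6 htr
  simp only [frameCoeff, Matrix.cons_val] at h3 h5 hcases
  have hgrad : ∀ z ∈ M, HasGrad (fun w => h (qpart w))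
      ![a * (tri c (-b, a) (a, b) (a, b) - tri c (a, b) (a, b) (-b, a)),
        b * (tri c (-b, a) (a, b) (a, b) - tri c (a, b) (a, b) (-b, a)), 0, 0] z := fun z hz => by
    refine (hh z hz).congr_grad fun i => ?_
    have k3 := h3
    have k6 := h6
    simp only [tri] at k3 k6
    fin_cases i <;> simp [tri]
    · linear_combination b * (k3 - k6) - (c 4 - c 1) * (a ^ 2 + b ^ 2 + 1) * hN
    · linear_combination -a * (k3 - k6) - (c 6 - c 3) * (a ^ 2 + b ^ 2 + 1) * hN
  have hexp : ∀ z ∈ M, _ := fun (z : Phase) (hz : z ∈ M) => And.intro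
    (tri_expand c hN (a, b) (a, b) (z 2, z 3)) (And.intro
    (tri_expand c hN (a, b) (-b, a) (z 2, z 3)) (And.intro
    (tri_expand c hN (-b, a) (a, b) (z 2, z 3)) (tri_expand c hN (-b, a) (-b, a) (z 2, z 3))))
  simp only [h0, h3, h5, h6, zero_mul, zero_add, add_zero] at hexp
  have hRT := fun z : Phase => frameRot_linTensor c h f hN z
  have hss := fun z hz => (mem_semisimpleLocus_linTensor c h f hN z).1 (hsol.semisimple hz)
  rcases hcases with ⟨h1, h2, h4⟩ | ⟨h1, h2, h7⟩ | ⟨hu, h1, h2, h7⟩ | ⟨hu, h1, h2, h7⟩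
  -- Only the last frame coefficient can be nonzero here, and f = 0, so the determinant part
  -- vanishes against regularity.
  · exfalso
    refine hreg0 (.inr fun z hz => ?_)
    obtain ⟨e1, e2, e3, e4⟩ := hexp z hz
    have hfz : f (qpart z) = 0 := by
      have := (hE z hz).2.2.1
      rw [h2] at this
      linarith
    simp only [h1, h2, h4, zero_mul] at e1 e2 e3
    have hdet : (a ^ 2 + b ^ 2) ^ 2 * ((c 2 * z 2 + c 3 * z 3) * (c 4 * z 2 + c 5 * z 3)
        - (c 0 * z 2 + c 1 * z 3) * (c 6 * z 2 + c 7 * z 3))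
        = tri c (a, b) (-b, a) (z 2, z 3) * tri c (-b, a) (a, b) (z 2, z 3)
          - tri c (a, b) (a, b) (z 2, z 3) * tri c (-b, a) (-b, a) (z 2, z 3) := by
      simp only [tri]; ring
    rw [hN, e1, e2] at hdet
    rw [hfz]
    linear_combination hdet
  -- In the frame the two diagonal entries coincide, one off-diagonal entry and f vanish, so the
  -- discriminant is zero against semisimplicity.
  · exfalso
    obtain ⟨z, hz⟩ := hne
    obtain ⟨e1, e2, e3, e4⟩ := hexp z hz
    have hfz : f (qpart z) = 0 := by
      have := (hE z hz).2.2.1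
      rw [h2] at this
      linarith
    apply hss z hz
    rw [e1, e2, e4, h1, h2, h7, hfz]
    ring
  · left
    set u := tri c (-b, a) (a, b) (a, b) with hudef
    have hfz : ∀ z ∈ M, f (qpart z) = -(u * g z) := fun z hz => by
      have := (hE z hz).2.2.1
      rw [h2] at this
      linear_combination this / 2
    obtain ⟨x₀, κ, C, hκ, hsolz⟩ := exists_inverse_square hM hconn.isPreconnected hN hu
      (fun z hz => (hgrad z hz).congr_grad fun i => by rw [h1, sub_zero]) gg gv
      (fun z hz => by
        have := (hE z hz).2.1
        rw [hfz z hz] at this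
        linear_combination this) hgne
    refine ⟨u, x₀, κ, C, hu, hκ, fun z hz => ?_⟩
    obtain ⟨hx0, hx, hvz, hgz⟩ := hsolz z hz
    obtain ⟨e1, e2, e3, e4⟩ := hexp z hz
    have hs := hss z hz
    have hR := hRT z
    simp only [e1, e2, e3, e4, h1, h2, h7, hfz z hz, hgz, hx] at hs hR
    generalize a * z 0 + b * z 1 + x₀ = x at *
    refine ⟨hx0, ?_, hvz, fun h => hs ?_⟩
    · rw [hR]
      ext i j
      fin_cases i <;> fin_cases j <;> simp [blockTensor] <;> ring
    -- The discriminant is 16u² times the expression assumed to vanish.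
    · have hx2 : κ / x ^ 2 = x * (κ / x ^ 3) := by field_simp
      rw [hx2] at h
      linear_combination 16 * u ^ 2 * h
  · right
    set u := tri c (-b, a) (a, b) (a, b) with hudef
    have hfz : ∀ z ∈ M, f (qpart z) = -(u / 2 * g z) := fun z hz => by
      have := (hE z hz).2.2.1
      rw [h2] at this
      linear_combination this / 2
    obtain ⟨h₀, K, C, hh0, hK, hsolz⟩ := exists_exponential hM hconn.isPreconnected hu
      (fun z hz => (hgrad z hz).congr_grad fun i => by
        rw [h1, sub_self, mul_zero, mul_zero]; fin_cases i <;> rfl) gg gv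
      (fun z hz => by
        have := (hE z hz).2.1
        rw [hfz z hz] at this
        linear_combination this) hgne
    refine ⟨u, h₀, K, C, hu, hh0, hK, fun z hz => ?_⟩
    obtain ⟨hx, hvz, hgz⟩ := hsolz z hz
    obtain ⟨e1, e2, e3, e4⟩ := hexp z hz
    have hR := hRT z
    simp only [e1, e2, e3, e4, h1, h2, h7, hfz z hz, hgz, hx] at hR
    refine ⟨?_, hvz⟩
    rw [hR]
    ext i j
    fin_cases i <;> fin_cases j <;> simp [blockTensor] <;> field_simp <;> ring

/-! ### Local equivalence with the Toda lattice -/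

theorem frameRot_mul_transpose {a b : ℝ} (hN : a ^ 2 + b ^ 2 = 1) :
    frameRot a b * (frameRot a b).transpose = 1 := by
  ext i j
  fin_cases i <;> fin_cases j <;>
    simp [frameRot, Matrix.mul_apply, Fin.sum_univ_four] <;>
    first | linear_combination hN | ring

theorem frameRot_mul_canP (a b : ℝ) : frameRot a b * canP = canP * frameRot a b := by
  ext i j
  fin_cases i <;> fin_cases j <;> simp [frameRot, canP, Matrix.mul_apply, Fin.sum_univ_four]

theorem frameRot_canonical {a b : ℝ} (hN : a ^ 2 + b ^ 2 = 1) :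
    frameRot a b * canP * (frameRot a b).transpose = canP := by
  rw [frameRot_mul_canP, Matrix.mul_assoc, frameRot_mul_transpose hN, Matrix.mul_one]

/-- The recursion operator acts on gradients in the same way in rotated coordinates. -/
theorem recOp_transpose_mulVec_frameRot {a b : ℝ} (hN : a ^ 2 + b ^ 2 = 1)
    {Q T : Matrix (Fin 4) (Fin 4) ℝ} (hT : frameRot a b * Q * (frameRot a b).transpose = T)
    (g : Fin 4 → ℝ) :
    (Q * canP⁻¹).transpose.mulVec (Matrix.vecMul g (frameRot a b))
      = Matrix.vecMul ((T * canP⁻¹).transpose.mulVec g) (frameRot a b) := by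
  have h1 := frameRot_mul_transpose hN
  have h2 := mul_eq_one_comm.1 h1
  rw [Matrix.mulVec_transpose, Matrix.vecMul_vecMul, Matrix.mulVec_transpose,
    Matrix.vecMul_vecMul, ← hT, canP_inv]
  congr 1
  rw [Matrix.mul_assoc _ (-canP), Matrix.neg_mul, ← frameRot_mul_canP,
    Matrix.mul_neg, Matrix.mul_neg, Matrix.mul_neg, Matrix.mul_assoc, Matrix.mul_assoc,
    ← Matrix.mul_assoc _ (frameRot a b) canP, h2, Matrix.one_mul]

/-- Local normal forms in rotated coordinates give local normal forms. -/
theorem exists_local_equivalence {M : Set Phase} (hM : IsOpen M) (hc : IsPreconnected M)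
    {P' : Phase → Matrix (Fin 4) (Fin 4) ℝ} {V : ℝ × ℝ → ℝ} {H₂ : Phase → ℝ}
    (hH : ContDiffOn ℝ ∞ H₂ M) (hLM : LenardMagriOn M P' (natHam V) H₂)
    {n₁ n₂ : ℝ} (hN : n₁ ^ 2 + n₂ ^ 2 = 1) (s : Phase)
    {F₁ F₂ : Phase → ℝ} {T : Phase → Matrix (Fin 4) (Fin 4) ℝ} {g₁ : Phase → Phase}
    {a b k C₁ : ℝ}
    (hT : ∀ w ∈ M, frameRot n₁ n₂ * P' w * (frameRot n₁ n₂).transpose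
      = T ((frameRot n₁ n₂).mulVec w + s))
    (hF : ∀ w ∈ M, natHam V w = F₁ ((frameRot n₁ n₂).mulVec w + s) + C₁)
    (hg₁ : ∀ w ∈ M, HasGrad F₁ (g₁ ((frameRot n₁ n₂).mulVec w + s))
      ((frameRot n₁ n₂).mulVec w + s))
    (hg₂ : ∀ w ∈ M, HasGrad F₂ ((T ((frameRot n₁ n₂).mulVec w + s) * canP⁻¹).transpose.mulVec
      (g₁ ((frameRot n₁ n₂).mulVec w + s))) ((frameRot n₁ n₂).mulVec w + s))
    (hφ : ∀ w ∈ M, ∃ (φ : Phase → Phase) (J : Phase → Matrix (Fin 4) (Fin 4) ℝ),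
      ∀ᶠ y in 𝓝 ((frameRot n₁ n₂).mulVec w + s),
        ContDiffAt ℝ ∞ φ y ∧ (∀ i, HasGrad (fun u => φ u i) (J y i) y) ∧
        J y * canP * (J y).transpose = canP ∧
        J y * T y * (J y).transpose = k • todaTensor a b (φ y) ∧
        F₁ y = natHam (todaV a b) (φ y) ∧ F₂ y = k * todaH₂ a b (φ y)) :
    ∃ C₂, ∀ z ∈ M, ∃ (W : Set Phase) (φ : Phase → Phase),
      IsOpen W ∧ z ∈ W ∧ W ⊆ M ∧ IsCanonicalOn W φ ∧
      ∀ w ∈ W, jacobian φ w * P' w * (jacobian φ w).transpose = k • todaTensor a b (φ w) ∧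
        natHam V w = natHam (todaV a b) (φ w) + C₁ ∧ H₂ w = k * todaH₂ a b (φ w) + C₂ := by
  set R := frameRot n₁ n₂ with hR
  have hH₁ : ∀ w ∈ M, HasGrad (natHam V) (Matrix.vecMul (g₁ (R.mulVec w + s)) R) w := fun w hw =>
    ((((hg₁ w hw).comp_affine R s).add (hasGrad_const C₁ w)).congr_of_eventuallyEq (by
      filter_upwards [hM.mem_nhds hw] with y hy using hF y hy)).congr_grad fun i => by simp
  -- Both functions have differential N* dH₁, so their difference is constant on the connected set
  -- M. This is why one C₂ serves all points.
  obtain ⟨C₂, hC₂⟩ := exists_const_of_hasGrad_zero hM hc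
    (F := fun w => H₂ w - F₂ (R.mulVec w + s)) fun w hw => by
      refine ((hasGrad_of_contDiffOn hM hH hw).sub
        ((hg₂ w hw).comp_affine R s)).congr_grad fun i => ?_
      rw [hLM.grad_eq hw, (hH₁ w hw).grad, recOp,
        recOp_transpose_mulVec_frameRot hN (hT w hw), sub_self]; rfl
  refine ⟨C₂, fun z hz => ?_⟩
  obtain ⟨φ, J, hJ⟩ := hφ z hz
  have hcont : Tendsto (fun w : Phase => R.mulVec w + s) (𝓝 z) (𝓝 (R.mulVec z + s)) :=
    (contDiff_affine R s).continuous.continuousAt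
  obtain ⟨W, hWo, hzW, hWM, hcan, hQ⟩ := exists_isCanonicalOn (hM.mem_nhds hz)
    (φ := fun w => φ (R.mulVec w + s)) (J := fun w => J (R.mulVec w + s) * R)
    (Q := fun w J => J * P' w * J.transpose = k • todaTensor a b (φ (R.mulVec w + s)) ∧
      F₁ (R.mulVec w + s) = natHam (todaV a b) (φ (R.mulVec w + s)) ∧
      F₂ (R.mulVec w + s) = k * todaH₂ a b (φ (R.mulVec w + s))) (by
      filter_upwards [hcont.eventually hJ, hM.mem_nhds hz] with w ⟨j1, j2, j3, j4, j5, j6⟩ hw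
      refine ⟨j1.comp w (contDiff_affine R s).contDiffAt, fun i => ?_, ?_, ?_, j5, j6⟩
      · exact (j2 i).comp_affine R s
      · rw [sandwich_mul (frameRot_canonical hN), j3]
      · rw [sandwich_mul (hT w hw), j4])
  refine ⟨W, _, hWo, hzW, hWM, hcan, fun w hw => ?_⟩
  obtain ⟨q1, q2, q3⟩ := hQ w hw
  refine ⟨q1, ?_, ?_⟩
  · rw [hF w (hWM hw), q2]
  · rw [← q3, ← hC₂ w (hWM hw)]; ring

theorem todaH₂_eq (a b : ℝ) (z : Phase) :
    todaH₂ a b z = (z 2 + z 3) * natHam (todaV a b) z - (z 2 + z 3) ^ 3 / 3 := rfl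

/-- The rotation by an eighth of a turn that maps an exponential potential to the Toda lattice. -/
theorem exists_toda_rotation {u h₀ : ℝ} (K : ℝ) (hu : u ≠ 0) (hh : h₀ ≠ 0) (z : Phase) :
    ∃ (φ : Phase → Phase) (J : Phase → Matrix (Fin 4) (Fin 4) ℝ), ∀ᶠ w in 𝓝 z,
      ContDiffAt ℝ ∞ φ w ∧ (∀ i, HasGrad (fun y => φ y i) (J w i) w) ∧
      J w * canP * (J w).transpose = canP ∧
      J w * (u • blockTensor (h₀ / u) (w 3) (w 2) (w 2) (w 3)
          (u / h₀ * (K * Real.exp (-(2 * u / h₀) * w 0)))) * (J w).transpose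
        = (√2 * u) • todaTensor (h₀ / (√2 * u)) (u * K / (√2 * h₀)) (φ w) ∧
      w 2 ^ 2 + w 3 ^ 2 + K * Real.exp (-(2 * u / h₀) * w 0)
        = natHam (todaV (h₀ / (√2 * u)) (u * K / (√2 * h₀))) (φ w) ∧
      φ w 2 + φ w 3 = √2 * w 3 := by
  have h2 : √2 ^ 2 = (2 : ℝ) := Real.sq_sqrt (by norm_num)
  have h20 : √2 ≠ (0 : ℝ) := by positivity
  generalize √2 = r at h2 h20
  -- The new positions are (y ± x)/√2, written with r = √2. Their difference is -√2 x, which fixes a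
  -- = h₀/(√2 u), and b is then determined by 2ab = K.
  have hr : r⁻¹ = r / 2 := by field_simp; linarith
  refine ⟨fun w => ![r / 2 * (w 1 + w 0), r / 2 * (w 1 - w 0), r / 2 * (w 3 + w 2),
    r / 2 * (w 3 - w 2)], fun _ => !![r / 2, r / 2, 0, 0; -(r / 2), r / 2, 0, 0;
      0, 0, r / 2, r / 2; 0, 0, -(r / 2), r / 2], .of_forall fun w => ?_⟩
  have harg : (r / 2 * (w 1 - w 0) - r / 2 * (w 1 + w 0)) / (h₀ / (r * u))
      = -(2 * u / h₀) * w 0 := by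
    field_simp
    linear_combination -2 * w 0 * h2
  refine ⟨?_, fun i => ?_, ?_, ?_, ?_, ?_⟩
  · rw [contDiffAt_pi]
    intro i
    fin_cases i <;> simp <;> fun_prop
  · fin_cases i
    · refine HasGrad.congr_grad (((hasGrad_coord 1 w).add (hasGrad_coord 0 w)).const_mul (r / 2))
        fun i => ?_
      fin_cases i <;> simp
    · refine HasGrad.congr_grad (((hasGrad_coord 1 w).sub (hasGrad_coord 0 w)).const_mul (r / 2))
        fun i => ?_
      fin_cases i <;> simp
    · refine HasGrad.congr_grad (((hasGrad_coord 3 w).add (hasGrad_coord 2 w)).const_mul (r / 2))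
        fun i => ?_
      fin_cases i <;> simp
    · refine HasGrad.congr_grad (((hasGrad_coord 3 w).sub (hasGrad_coord 2 w)).const_mul (r / 2))
        fun i => ?_
      fin_cases i <;> simp
  · ext i j
    fin_cases i <;> fin_cases j <;> simp [canP, Matrix.mul_apply, Fin.sum_univ_four] <;> linarith
  · rw [todaTensor_eq_blockTensor]
    simp only [Matrix.cons_val, Matrix.cons_val_zero, Matrix.cons_val_one, harg]
    generalize Real.exp (-(2 * u / h₀) * w 0) = E
    ext i j
    fin_cases i <;> fin_cases j <;>
      simp [blockTensor, Matrix.mul_apply, Fin.sum_univ_four]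
    all_goals field_simp
    all_goals first
      | ring1
      | linear_combination 2 * h2
      | linear_combination -2 * h2
      | linear_combination 2 * K * E * h2
      | linear_combination -2 * K * E * h2
  · simp only [natHam, todaV, qpart, Matrix.cons_val, Matrix.cons_val_zero, Matrix.cons_val_one,
      harg]
    generalize Real.exp (-(2 * u / h₀) * w 0) = E
    field_simp
    linear_combination (4 * K * E - 2 * r ^ 2 * (w 2 ^ 2 + w 3 ^ 2)) * h2
  · simp; ring

theorem IsNontrivialSolution.exists_toda_equivalence {M : Set Phase} {c : Fin 8 → ℝ}
    {h f V : ℝ × ℝ → ℝ} {H₂ : Phase → ℝ} (hM : IsOpen M) (hconn : IsConnected M)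
    (hsol : IsNontrivialSolution M (linTensor c h f) V H₂) :
    ∃ a b k C₁ C₂ : ℝ, a ≠ 0 ∧ b ≠ 0 ∧ k ≠ 0 ∧
      ∀ z ∈ M, ∃ (W : Set Phase) (φ : Phase → Phase),
        IsOpen W ∧ z ∈ W ∧ W ⊆ M ∧ IsCanonicalOn W φ ∧
        ∀ w ∈ W,
          jacobian φ w * linTensor c h f w * (jacobian φ w).transpose
            = k • todaTensor a b (φ w) ∧
          natHam V w = natHam (todaV a b) (φ w) + C₁ ∧
          H₂ w = k * todaH₂ a b (φ w) + C₂ := by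
  obtain ⟨n₁, n₂, hN, hcase⟩ := hsol.classification hM hconn
  have hρ : ∀ (x₀ : ℝ) (w : Phase), (frameRot n₁ n₂).mulVec w + ![x₀, 0, 0, 0]
      = ![n₁ * w 0 + n₂ * w 1 + x₀, -n₂ * w 0 + n₁ * w 1, n₁ * w 2 + n₂ * w 3,
        -n₂ * w 2 + n₁ * w 3] := fun x₀ w => by
    ext i
    fin_cases i <;> simp [frameRot, dotProduct, Fin.sum_univ_four]
  have hkin : ∀ w : Phase, w 2 ^ 2 + w 3 ^ 2
      = (n₁ * w 2 + n₂ * w 3) ^ 2 + (-n₂ * w 2 + n₁ * w 3) ^ 2 := fun w => by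
    linear_combination -(w 2 ^ 2 + w 3 ^ 2) * hN
  rcases hcase with ⟨u, x₀, κ, C, hu, hκ, hall⟩ | ⟨u, h₀, K, C, hu, hh, hK, hall⟩
  -- The discriminant has no zero on the connected set M, so its sign s is constant and can serve as
  -- the Toda constant b at all points.
  · obtain ⟨s, hs0, hs⟩ : ∃ s : ℝ, s ≠ 0 ∧ ∀ w ∈ M,
        s = 1 ∧ 0 < invSqDisc κ ((frameRot n₁ n₂).mulVec w + ![x₀, 0, 0, 0]) ∨
        s = -1 ∧ invSqDisc κ ((frameRot n₁ n₂).mulVec w + ![x₀, 0, 0, 0]) < 0 := by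
      have hD : ∀ w ∈ M, invSqDisc κ ((frameRot n₁ n₂).mulVec w + ![x₀, 0, 0, 0]) ≠ 0 :=
        fun w hw => by
          have := (hall w hw).2.2.2
          rw [hρ]
          simpa [invSqDisc, div_eq_mul_inv] using this
      have hcont : ContinuousOn
          (fun w => invSqDisc κ ((frameRot n₁ n₂).mulVec w + ![x₀, 0, 0, 0])) M := fun w hw => by
        refine ContinuousAt.continuousWithinAt ?_
        have hx : ((frameRot n₁ n₂).mulVec w + ![x₀, 0, 0, 0]) 0 ≠ 0 := by
          rw [hρ]; exact (hall w hw).1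
        exact ContinuousAt.comp (f := fun w => (frameRot n₁ n₂).mulVec w + ![x₀, 0, 0, 0])
          (contDiffAt_invSqDisc κ hx).continuousAt (contDiff_affine _ _).continuous.continuousAt
      obtain ⟨z, hz⟩ := hconn.nonempty
      have hcon : ∀ w ∈ M, ∀ w' ∈ M,
          invSqDisc κ ((frameRot n₁ n₂).mulVec w + ![x₀, 0, 0, 0]) < 0 →
          0 < invSqDisc κ ((frameRot n₁ n₂).mulVec w' + ![x₀, 0, 0, 0]) → False := by
        intro w hw w' hw' hl hg
        obtain ⟨y, hy, hy0⟩ := hconn.isPreconnected.intermediate_value hw hw' hcont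
          (Set.mem_Icc.2 ⟨hl.le, hg.le⟩)
        exact hD y hy hy0
      rcases lt_or_gt_of_ne (hD z hz) with hz0 | hz0
      · refine ⟨-1, by norm_num, fun w hw => .inr ⟨rfl, ?_⟩⟩
        exact (hD w hw).lt_of_le (not_lt.1 fun h => hcon z hz w hw hz0 h)
      · refine ⟨1, by norm_num, fun w hw => .inl ⟨rfl, ?_⟩⟩
        exact (hD w hw).symm.lt_of_le (not_lt.1 fun h => hcon w hw z hz h hz0)
    obtain ⟨C₂, hC₂⟩ := exists_local_equivalence hM hconn.isPreconnected hsol.smooth_H₂ hsol.chain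
      hN ![x₀, 0, 0, 0] (a := 1) (b := s) (k := 2 * u) (C₁ := C)
      (F₁ := fun y => y 2 ^ 2 + y 3 ^ 2 + κ * (y 0 ^ 2)⁻¹)
      -- This is 2u times the Toda integral, as the total Toda momentum is y 3.
      (F₂ := fun y => 2 * u * (y 3 * (y 2 ^ 2 + y 3 ^ 2 + κ * (y 0 ^ 2)⁻¹) - 1 / 3 * y 3 ^ 3))
      (T := fun y => (2 * u) • invSqTensor κ y)
      (g₁ := fun y => ![-(2 * κ / y 0 ^ 3), 0, 2 * y 2, 2 * y 3])
      (fun w hw => by rw [(hall w hw).2.1, hρ]; simp [invSqTensor])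
      (fun w hw => by
        rw [hρ, natHam, (hall w hw).2.2.1, hkin]
        simp [div_eq_mul_inv]; ring)
      (fun w hw => by
        have hx : ((frameRot n₁ n₂).mulVec w + ![x₀, 0, 0, 0]) 0 ≠ 0 := by
          rw [hρ]; exact (hall w hw).1
        generalize (frameRot n₁ n₂).mulVec w + ![x₀, 0, 0, 0] = y at hx
        refine HasGrad.congr_grad ((((hasGrad_coord 2 y).pow 2).add ((hasGrad_coord 3 y).pow 2)).add
          ((((hasGrad_coord 0 y).pow 2).inv (pow_ne_zero 2 hx)).const_mul κ)) fun i => ?_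
        fin_cases i <;> simp <;> field_simp)
      (fun w hw => by
        have hx : ((frameRot n₁ n₂).mulVec w + ![x₀, 0, 0, 0]) 0 ≠ 0 := by
          rw [hρ]; exact (hall w hw).1
        generalize (frameRot n₁ n₂).mulVec w + ![x₀, 0, 0, 0] = y at hx
        rw [Matrix.smul_mul, Matrix.transpose_smul, Matrix.smul_mulVec, invSqTensor,
          transpose_mulVec_blockTensor]
        refine HasGrad.congr_grad ((((hasGrad_coord 3 y).mul
          ((((hasGrad_coord 2 y).pow 2).add ((hasGrad_coord 3 y).pow 2)).add
          ((((hasGrad_coord 0 y).pow 2).inv (pow_ne_zero 2 hx)).const_mul κ))).sub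
          (((hasGrad_coord 3 y).pow 3).const_mul (1 / 3))).const_mul (2 * u)) fun i => ?_
        fin_cases i <;> simp [-mul_eq_mul_left_iff, -mul_eq_zero, -zero_eq_mul] <;> field_simp <;> ring)
      (fun w hw => by
        have hx : ((frameRot n₁ n₂).mulVec w + ![x₀, 0, 0, 0]) 0 ≠ 0 := by
          rw [hρ]; exact (hall w hw).1
        obtain ⟨φ, J, hJ⟩ := exists_toda_map hκ hx (hs w hw)
        refine ⟨φ, J, hJ.mono ?_⟩
        rintro y ⟨j1, j2, j3, j4, j5, j6⟩
        refine ⟨j1, j2, j3, ?_, ?_, ?_⟩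
        · rw [Matrix.mul_smul, Matrix.smul_mul, j4]
        · rw [j5]; rfl
        · rw [todaH₂_eq, j5, j6]; ring)
    exact ⟨1, s, 2 * u, C, C₂, one_ne_zero, hs0, mul_ne_zero two_ne_zero hu, hC₂⟩
  · have h20 : √2 ≠ (0 : ℝ) := by positivity
    obtain ⟨C₂, hC₂⟩ := exists_local_equivalence hM hconn.isPreconnected hsol.smooth_H₂ hsol.chain
      hN ![0, 0, 0, 0] (a := h₀ / (√2 * u)) (b := u * K / (√2 * h₀)) (k := √2 * u) (C₁ := C)
      (F₁ := fun y => y 2 ^ 2 + y 3 ^ 2 + K * Real.exp (-(2 * u / h₀) * y 0))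
      -- Here the total Toda momentum is √2 y 3 and k = √2 u, which turns the factor 1/3 into 2/3.
      (F₂ := fun y => 2 * u * (y 3 * (y 2 ^ 2 + y 3 ^ 2 + K * Real.exp (-(2 * u / h₀) * y 0))
        - 2 / 3 * y 3 ^ 3))
      (T := fun y => u • blockTensor (h₀ / u) (y 3) (y 2) (y 2) (y 3)
          (u / h₀ * (K * Real.exp (-(2 * u / h₀) * y 0))))
      (g₁ := fun y => ![-(2 * u / h₀) * (K * Real.exp (-(2 * u / h₀) * y 0)), 0, 2 * y 2, 2 * y 3])
      (fun w hw => by rw [(hall w hw).1, hρ]; simp)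
      (fun w hw => by
        rw [hρ, natHam, (hall w hw).2, hkin]
        simp; ring)
      (fun w hw => by
        generalize (frameRot n₁ n₂).mulVec w + ![0, 0, 0, 0] = y
        refine HasGrad.congr_grad ((((hasGrad_coord 2 y).pow 2).add ((hasGrad_coord 3 y).pow 2)).add
          ((((hasGrad_coord 0 y).const_mul (-(2 * u / h₀))).exp).const_mul K)) fun i => ?_
        fin_cases i <;> simp <;> ring)
      (fun w hw => by
        generalize (frameRot n₁ n₂).mulVec w + ![0, 0, 0, 0] = y
        rw [Matrix.smul_mul, Matrix.transpose_smul, Matrix.smul_mulVec,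
          transpose_mulVec_blockTensor]
        refine HasGrad.congr_grad ((((hasGrad_coord 3 y).mul
          ((((hasGrad_coord 2 y).pow 2).add ((hasGrad_coord 3 y).pow 2)).add
          ((((hasGrad_coord 0 y).const_mul (-(2 * u / h₀))).exp).const_mul K))).sub
          (((hasGrad_coord 3 y).pow 3).const_mul (2 / 3))).const_mul (2 * u)) fun i => ?_
        fin_cases i <;> simp [-mul_eq_mul_left_iff, -mul_eq_zero, -zero_eq_mul] <;> field_simp <;> ring)
      (fun w hw => by
        obtain ⟨φ, J, hJ⟩ := exists_toda_rotation K hu hh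
          ((frameRot n₁ n₂).mulVec w + ![0, 0, 0, 0])
        refine ⟨φ, J, hJ.mono ?_⟩
        rintro y ⟨j1, j2, j3, j4, j5, j6⟩
        refine ⟨j1, j2, j3, j4, j5, ?_⟩
        have h2 : √2 ^ 2 = (2 : ℝ) := Real.sq_sqrt (by norm_num)
        rw [todaH₂_eq, ← j5, j6]
        generalize √2 = r at h2
        linear_combination (-u * (y 3 * (y 2 ^ 2 + y 3 ^ 2 + K * Real.exp (-(2 * u / h₀) * y 0)))
          + u * y 3 ^ 3 / 3 * (r ^ 2 + 2)) * h2)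
    exact ⟨_, _, _, C, C₂, div_ne_zero hh (mul_ne_zero h20 hu),
      div_ne_zero (mul_ne_zero hu hK) (mul_ne_zero h20 hh), mul_ne_zero h20 hu, hC₂⟩

theorem mainTheorem1 :
    -- the open Toda lattice belongs to the ansatz and is a nontrivial solution
    (∀ a b : ℝ, a ≠ 0 → b ≠ 0 →
      (∃ (c : Fin 8 → ℝ) (h f : ℝ × ℝ → ℝ), todaTensor a b = linTensor c h f) ∧
      IsOpen (semisimpleLocus (todaTensor a b)) ∧
      Dense (semisimpleLocus (todaTensor a b)) ∧
      (0 < a * b → semisimpleLocus (todaTensor a b) = Set.univ) ∧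
      ∀ M : Set Phase, IsOpen M → M.Nonempty → M ⊆ semisimpleLocus (todaTensor a b) →
        IsNontrivialSolution M (todaTensor a b) (todaV a b) (todaH₂ a b)) ∧
    -- every nontrivial solution in the ansatz is canonically equivalent to it
    (∀ (M : Set Phase) (c : Fin 8 → ℝ) (h f V : ℝ × ℝ → ℝ) (H₂ : Phase → ℝ),
      IsOpen M → IsConnected M → IsNontrivialSolution M (linTensor c h f) V H₂ →
      ∃ a b k C₁ C₂ : ℝ, a ≠ 0 ∧ b ≠ 0 ∧ k ≠ 0 ∧
        ∀ z ∈ M, ∃ (W : Set Phase) (φ : Phase → Phase),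
          IsOpen W ∧ z ∈ W ∧ W ⊆ M ∧ IsCanonicalOn W φ ∧
          ∀ w ∈ W,
            jacobian φ w * linTensor c h f w * (jacobian φ w).transpose
              = k • todaTensor a b (φ w) ∧
            natHam V w = natHam (todaV a b) (φ w) + C₁ ∧
            H₂ w = k * todaH₂ a b (φ w) + C₂) := by
  refine ⟨fun a b ha hb => ⟨⟨![1, 0, 0, 0, 0, 0, 0, 1], fun _ => a,
    fun q => b * Real.exp ((q.2 - q.1) / a), ?_⟩, isOpen_semisimpleLocus_toda a b,
    dense_semisimpleLocus_toda ha hb, semisimpleLocus_toda_of_pos, fun M hM hne hss =>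
    isNontrivialSolution_toda ha hb hM hne hss⟩,
    fun M c h f V H₂ hM hconn hsol => hsol.exists_toda_equivalence hM hconn⟩
  funext z
  rw [todaTensor_eq_blockTensor, linTensor_eq_blockTensor]
  simp [qpart]
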